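/- Let $G$ be a group, $H\le G$ a subgroup and $\theta\colon H\to G$ an injective homomorphism, and let \[\Gamma=\operatorname{HNN}(G,H,\theta)=\langle G,\tau\mid \tau^{-1}h\tau=\theta(h)\text{ for all }h\in H\rangle\] be the corresponding HNN extension. Assume that $\Gamma$ is non-ascending, i.e. $H\ne G$ and $\theta(H)\ne G$, and that $H\cap\theta(H)$ is finite. Put $H_{-1}=H$, $H_1=\theta(H)$, and for $\varepsilon\in\{\pm1\}$ let $S_\varepsilon\ni 1$ be a system of representatives of the left cosets of $H_\varepsilon$ in $G$. Every $g\in\Gamma$ has a unique normal form $g=g_1\tau^{\varepsilon_1}\cdots g_n\tau^{\varepsilon_n}g_{n+1}$ with $n\ge 0$, $\varepsilon_i\in\{\pm1\}$, $g_i\in S_{-\varepsilon_i}$ for $1\le i\le n$, $g_{n+1}\in G$, and such that $g_i=1$ implies $\varepsilon_{i-1}=\varepsilon_i$ for $2\le i\le n$. For $\varepsilon\in\{\pm1\}$ let $T_\varepsilon^\dagger$ be the set of all $g\in\Gamma$ whose normal form has $n\ge1$, $\varepsilon_1=\varepsilon$ and $g_1=1$. Put \[\ker\Gamma=\bigcap_{r\in\Gamma}rHr^{-1},\qquad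 K_\varepsilon=\bigcap_{r\in\Gamma\setminus T_\varepsilon^\dagger}rHr^{-1},\] and let $\operatorname{int}\Gamma$ be the normal closure in $\Gamma$ of either one of the quasi-kernels $K_{-1}$, $K_1$ (the two normal closures coincide; the statement holds for either choice). Then the following are equivalent: (i) $\Gamma$ is icc, i.e. every conjugacy class of $\Gamma$ other than $\{1\}$ is infinite; (ii) $\ker\Gamma=\{1\}$; (iii) $\operatorname{int}\Gamma=\{1\}$; (iv) $\Gamma$ is a Powers group, i.e. for every non-empty finite set $F\subseteq\Gamma\setminus\{1\}$ and every integer $N\ge1$ there are a partition $\Gamma=C\sqcup D$ and elements $\gamma_1,\dots,\gamma_N\in\Gamma$ such that $fC\cap C=\emptyset$ for all $f\in F$ and $\gamma_jD\cap\gamma_kD=\emptyset$ for all $j\neq k$; (v) $\Gamma$ is $C^*$-simple, i.e. the reduced group $C^*$-algebra $C^*_r(\Gamma)$ (the $C^*$-subalgebra of $B(\ell^2(\Gamma))$ generated by the left regular representation) has no non-trivial proper closed two-sided ideals; (vi) $\Gamma$ has the unique trace property, i.e. the canonical trace $a\mapsto\langle a\delta_1,\delta_1\rangle$ is the only tracial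 state on $C^*_r(\Gamma)$. -/

import Mathlib

open scoped Pointwise ComplexOrder

/-! ### Group-theoretic properties -/

/-- A group is icc if every conjugacy class other than `{1}` is infinite. -/
def IsICC (Γ : Type*) [Group Γ] : Prop :=
  ∀ g : Γ, g ≠ 1 → {x : Γ | ∃ c : Γ, x = c * g * c⁻¹}.Infinite

/-- Powers groups in the sense of de la Harpe: for every non-empty finite `F ⊆ Γ \ {1}` and every
`N ≥ 1` there are a partition `Γ = C ⊔ D` and `γ₁, …, γ_N ∈ Γ` with `fC ∩ C = ∅` for all `f ∈ F`
and `γ_j D ∩ γ_k D = ∅` for all `j ≠ k`. -/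
def IsPowersGroup (Γ : Type*) [Group Γ] : Prop :=
  ∀ F : Finset Γ, F.Nonempty → 1 ∉ F → ∀ N : ℕ, 1 ≤ N →
    ∃ (C D : Set Γ) (γ : Fin N → Γ), C ∪ D = Set.univ ∧ C ∩ D = ∅ ∧
      (∀ f ∈ F, (f • C) ∩ C = ∅) ∧
      ∀ j k : Fin N, j ≠ k → (γ j • D) ∩ (γ k • D) = ∅

/-! ### The reduced group C*-algebra -/

section ReducedCStar

variable (Γ : Type*) [Group Γ]

/-- The Hilbert space `ℓ²(Γ)`. -/
abbrev EllTwo : Type _ := lp (fun _ : Γ => ℂ) 2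

variable {Γ}

theorem memlp_translate (g : Γ) (f : EllTwo Γ) :
    Memℓp (fun h => f (g⁻¹ * h) : Γ → ℂ) 2 := by
  have h2 : (0 : ℝ) < (2 : ENNReal).toReal := by norm_num
  have hf := (memℓp_gen_iff h2).1 (lp.memℓp f)
  exact (memℓp_gen_iff h2).2 ((Equiv.mulLeft g⁻¹).summable_iff.2 hf)

/-- The left translation `(λ(g) f)(h) = f (g⁻¹ h)`, as a linear isometry of `ℓ²(Γ)`. -/
noncomputable def leftTranslation (g : Γ) : EllTwo Γ →ₗᵢ[ℂ] EllTwo Γ where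
  toFun f := ⟨fun h => f (g⁻¹ * h), memlp_translate g f⟩
  map_add' _ _ := rfl
  map_smul' _ _ := rfl
  norm_map' f := by
    have h2 : (0 : ℝ) < (2 : ENNReal).toReal := by norm_num
    rw [lp.norm_eq_tsum_rpow h2, lp.norm_eq_tsum_rpow h2]
    congr 1
    exact (Equiv.mulLeft g⁻¹).tsum_eq (fun h => ‖f h‖ ^ (2 : ENNReal).toReal)

/-- The left regular representation, `λ(g) ∈ B(ℓ²(Γ))`. -/
noncomputable def leftRegular (g : Γ) : EllTwo Γ →L[ℂ] EllTwo Γ :=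
  (leftTranslation g).toContinuousLinearMap

/-- The basis vector `δ_g` of `ℓ²(Γ)`. -/
noncomputable def delta (g : Γ) : EllTwo Γ :=
  letI := Classical.decEq Γ
  lp.single 2 g (1 : ℂ)

theorem leftRegular_delta (g h : Γ) : leftRegular g (delta h) = delta (g * h) := by
  classical
  ext x
  change (delta h) (g⁻¹ * x) = (delta (g * h)) x
  simp only [delta, lp.single_apply, Pi.single_apply, inv_mul_eq_iff_eq_mul]

variable (Γ)

/-- The reduced group C*-algebra: the C*-subalgebra of `B(ℓ²(Γ))` generated by `λ(Γ)`. -/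
noncomputable def reducedCStarAlgebra : StarSubalgebra ℂ (EllTwo Γ →L[ℂ] EllTwo Γ) :=
  (StarAlgebra.adjoin ℂ (Set.range (leftRegular (Γ := Γ)))).topologicalClosure

/-- `Γ` is C*-simple if the only closed two-sided ideals of its reduced C*-algebra are
the two trivial ones. -/
def IsCStarSimple : Prop :=
  ∀ I : TwoSidedIdeal (reducedCStarAlgebra Γ),
    IsClosed (I : Set (reducedCStarAlgebra Γ)) → I = ⊥ ∨ I = ⊤

variable {Γ}

/-- Tracial states on the reduced group C*-algebra: positive unital linear functionals `φ` with
`φ(ab) = φ(ba)`. -/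
structure IsTracialState (φ : reducedCStarAlgebra Γ →ₗ[ℂ] ℂ) : Prop where
  nonneg : ∀ a : reducedCStarAlgebra Γ, 0 ≤ (a : EllTwo Γ →L[ℂ] EllTwo Γ) → 0 ≤ φ a
  map_one : φ 1 = 1
  map_mul_comm : ∀ a b : reducedCStarAlgebra Γ, φ (a * b) = φ (b * a)

variable (Γ)

/-- The canonical trace, `a ↦ ⟨a δ₁, δ₁⟩` (Mathlib's inner product is linear in its second
argument). -/
noncomputable def canonicalTrace : reducedCStarAlgebra Γ →ₗ[ℂ] ℂ where
  toFun a := inner ℂ (delta (1 : Γ)) ((a : EllTwo Γ →L[ℂ] EllTwo Γ) (delta (1 : Γ)))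
  map_add' a b := by simp
  map_smul' c a := by simp

/-- The canonical trace is the one and only tracial state on the reduced C*-algebra. -/
def HasUniqueTraceProperty : Prop :=
  ∀ φ : reducedCStarAlgebra Γ →ₗ[ℂ] ℂ, IsTracialState φ ↔ φ = canonicalTrace Γ

end ReducedCStar

/-! ### HNN extensions -/

namespace HNN

variable {G : Type*} [Group G] {H : Subgroup G} (θ : H →* G) (hθ : Function.Injective θ)

/-- `HNN(G, H, θ) = ⟨G, τ ∣ τ⁻¹ h τ = θ(h) for all h ∈ H⟩`, for an injective homomorphism
`θ : H → G`. Mathlib's stable letter `t` satisfies `t h t⁻¹ = θ(h)`, so that `τ = t⁻¹`. -/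
abbrev Ext : Type _ := HNNExtension G H θ.range (MonoidHom.ofInjective hθ)

/-- The stable letter `τ`. -/
noncomputable def stable : Ext θ hθ := (HNNExtension.t)⁻¹

theorem stable_conj (h : H) :
    (stable θ hθ)⁻¹ * HNNExtension.of (h : G) * stable θ hθ = HNNExtension.of (θ h) := by
  have := HNNExtension.equiv_eq_conj (φ := MonoidHom.ofInjective hθ) h
  rw [stable, inv_inv]
  exact this.symm

/-- The extension is non-ascending if `H ≠ G` and `θ(H) ≠ G`. -/
def NonAscending : Prop := H ≠ ⊤ ∧ θ.range ≠ ⊤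

/-- `H₋₁ = H` and `H₁ = θ(H)`. -/
def assoc (ε : ℤˣ) : Subgroup G := if ε = 1 then θ.range else H

/-- `S₋₁` and `S₁` are systems of representatives for the left cosets of `H₋₁ = H` and `H₁ = θ(H)`
in `G`, both containing `1`. -/
def IsTransversal (S : ℤˣ → Set G) : Prop :=
  ∀ ε : ℤˣ, 1 ∈ S ε ∧ ∀ g : G, ∃! s : G, s ∈ S ε ∧ s⁻¹ * g ∈ assoc θ ε

/-- Normal forms `g₁ τ^ε₁ g₂ τ^ε₂ ⋯ gₙ τ^εₙ gₙ₊₁`: the list of the pairs `(gᵢ, εᵢ)` with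
`gᵢ ∈ S_{-εᵢ}`, such that `gᵢ = 1` implies `εᵢ₋₁ = εᵢ`, and the end letter `gₙ₊₁ ∈ G`. -/
structure NormalForm (S : ℤˣ → Set G) where
  letters : List (G × ℤˣ)
  endLetter : G
  mem : ∀ p ∈ letters, p.1 ∈ S (-p.2)
  chain : letters.IsChain (fun p q => q.1 = 1 → p.2 = q.2)

/-- The element of the HNN extension that a normal form represents. -/
noncomputable def NormalForm.value {S : ℤˣ → Set G} (w : NormalForm S) : Ext θ hθ :=
  (w.letters.map fun p => HNNExtension.of p.1 * stable θ hθ ^ (p.2 : ℤ)).prod *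
    HNNExtension.of w.endLetter

/-- `T_ε†`: the elements of length at least `1` and type `ε` (that is, `ε₁ = ε`) whose initial
letter `g₁` is `1`. -/
def typeDagger (S : ℤˣ → Set G) (ε : ℤˣ) : Set (Ext θ hθ) :=
  {g | ∃ w : NormalForm S, w.value θ hθ = g ∧ w.letters.head? = some (1, ε)}

/-- The conjugate `r H r⁻¹` of `H` in the HNN extension. -/
noncomputable def conjBase (r : Ext θ hθ) : Subgroup (Ext θ hθ) :=
  (H.map HNNExtension.of).map (MulAut.conj r).toMonoidHom

/-- `ker Γ`, the intersection of all `r H r⁻¹`, `r ∈ Γ`. -/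
noncomputable def kernel : Subgroup (Ext θ hθ) := ⨅ r : Ext θ hθ, conjBase θ hθ r

/-- The quasi-kernel `K_ε`, the intersection of the `r H r⁻¹`, `r ∈ Γ \ T_ε†`. -/
noncomputable def quasiKernel (S : ℤˣ → Set G) (ε : ℤˣ) : Subgroup (Ext θ hθ) :=
  ⨅ r ∈ (typeDagger θ hθ S ε)ᶜ, conjBase θ hθ r

/-- `int Γ`: the normal closure of the quasi-kernel `K_ε`. -/
noncomputable def interior (S : ℤˣ → Set G) (ε : ℤˣ) : Subgroup (Ext θ hθ) :=
  Subgroup.normalClosure (quasiKernel θ hθ S ε : Set (Ext θ hθ))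

end HNN

/-! ### Half-spaces of an HNN extension -/

namespace HNNExtension

open NormalWord

/-! The proof reads the Bass–Serre tree of `Γ` off reduced words. Vertices are the cosets `xG`, and
`halfSpace φ u` consists of the `x` whose vertex lies beyond the edge from `G` to `t ^ u G`.
Britton's lemma supplies the tree geometry: distinct directions at a vertex are disjoint, and a
half-tree and its complement are the two sides of one edge (`units_pow_mul_mem_halfSpace_iff`,
`mul_mem_halfSpace`).

Finiteness of `H ∩ θ(H)` makes the quasi-kernels finite. Some elements `g` push the defining
half-tree strictly into itself, so that `g K g⁻¹ ≤ K`; for finite `K` this is an equality. Such `g`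
generate `Γ`, hence `K` is normal and equals `ker Γ` (`HNN.quasiKernel_le_kernel`). This gives (ii)
⇔ (iii).

If `ker Γ` is trivial, no nontrivial element fixes a half-tree. As the extension is non-ascending,
each vertex has at least four directions. One can therefore shrink a half-tree step by step until
every element of a finite set moves it off itself, while its complement has arbitrarily many
disjoint translates. This is the Powers property (`isPowersGroup_of_halfSpace`).

A Powers group is icc by a pigeonhole argument. For the C*-properties, Powers' estimate bounds a sum
of `N` suitable conjugates of an element of trace zero by a multiple of `√N`, so that averages tend
to the trace. Conversely, a nontrivial finite normal subgroup, such as a nontrivial `ker Γ`, has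
finite conjugacy classes, a second trace and a proper closed ideal. -/

theorem exists_snoc_of_head? {α β : Type*} {l : List (α × β)} {u : α}
    (hu : l.head?.map Prod.fst = some u) : ∃ l' v g, l = l' ++ [(v, g)] := by
  rcases List.eq_nil_or_concat' l with rfl | ⟨l', ⟨v, g⟩, rfl⟩
  · simp at hu
  · exact ⟨l', v, g, rfl⟩

variable {G : Type*} [Group G] {A B : Subgroup G} (φ : A ≃* B)

/-- The elements that have a reduced word beginning with `t ^ u`. -/
def halfSpace (u : ℤˣ) : Set (HNNExtension G A B φ) :=
  {x | ∃ w : ReducedWord G A B,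
    w.head = 1 ∧ w.toList.head?.map Prod.fst = some u ∧ w.prod φ = x}

theorem exists_reducedWord (x : HNNExtension G A B φ) :
    ∃ w : ReducedWord G A B, w.prod φ = x := by
  obtain ⟨d⟩ := TransversalPair.nonempty G A B
  exact ⟨((NormalWord.equiv φ d) x).toReducedWord, (NormalWord.equiv φ d).symm_apply_apply x⟩

theorem exists_of_mul_units_pow (u : ℤˣ) {a : G} (ha : a ∈ toSubgroup A B (-u)) :
    ∃ b ∈ toSubgroup A B u,
      (of a : HNNExtension G A B φ) * t ^ (u : ℤ) = t ^ (u : ℤ) * of b := by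
  rcases Int.units_eq_one_or u with rfl | rfl
  · exact ⟨_, (φ.symm ⟨a, ha⟩).2, by simpa using of_mul_t (φ := φ) ⟨a, ha⟩⟩
  · exact ⟨_, (φ ⟨a, ha⟩).2, by simpa using of_mul_inv_t (φ := φ) ⟨a, ha⟩⟩

variable {φ}

theorem of_mul_prod_mem_halfSpace (w : ReducedWord G A B) {u : ℤˣ}
    (hu : w.toList.head?.map Prod.fst = some u) : of w.head⁻¹ * w.prod φ ∈ halfSpace φ u :=
  ⟨⟨1, w.toList, w.chain⟩, rfl, hu, by simp [ReducedWord.prod, ← mul_assoc]⟩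

/-- Distinct directions at the base vertex are disjoint, and `toSubgroup A B (-u)` is the stabilizer
of the edge from `G` to `t ^ u G`. Both follow from the uniqueness part of Britton's lemma. -/
theorem eq_and_mem_of_of_mul_mem {x : HNNExtension G A B φ} {g : G} {u v : ℤˣ}
    (hx : x ∈ halfSpace φ u) (hg : of g * x ∈ halfSpace φ v) :
    u = v ∧ g ∈ toSubgroup A B (-u) := by
  obtain ⟨w, hw, hu, rfl⟩ := hx
  obtain ⟨w', hw', hv, h⟩ := hg
  obtain ⟨h1, h2⟩ := ReducedWord.map_fst_eq_and_of_prod_eq φ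
    (w₁ := ⟨g, w.toList, w.chain⟩) (w₂ := w') (by
      rw [h]; simp [ReducedWord.prod, hw])
  have h3 := h2 u (by simp [hu])
  rw [hw', mul_one, inv_mem_iff] at h3
  refine ⟨?_, h3⟩
  have := congrArg List.head? h1
  simp only [List.head?_map] at this
  rw [hu, hv] at this
  exact Option.some_injective _ this

theorem of_mul_mem_halfSpace {x : HNNExtension G A B φ} {g : G} {u : ℤˣ}
    (hx : x ∈ halfSpace φ u) (hg : g ∈ toSubgroup A B (-u)) : of g * x ∈ halfSpace φ u := by
  obtain ⟨⟨h, l, hl⟩, hw, hu, rfl⟩ := hx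
  obtain rfl : h = 1 := hw
  match l, hl, hu with
  | [], _, hu => simp at hu
  | (v, k) :: l, hl, hu =>
    obtain rfl : v = u := by simpa using hu
    obtain ⟨b, hb, hgb⟩ := exists_of_mul_units_pow φ v hg
    refine ⟨⟨1, (v, b * k) :: l, ?_⟩, rfl, rfl, ?_⟩
    · rw [List.isChain_cons] at hl ⊢
      exact ⟨fun y hy hbk => hl.1 y hy ((Subgroup.mul_mem_cancel_left _ hb).1 hbk), hl.2⟩
    · simp [ReducedWord.prod, ← mul_assoc, hgb]

theorem of_notMem_halfSpace (g : G) (u : ℤˣ) :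
    (of g : HNNExtension G A B φ) ∉ halfSpace φ u := by
  rintro ⟨w, hw, hu, h⟩
  have := ReducedWord.toList_eq_nil_of_mem_of_range φ w ⟨g, h.symm⟩
  simp [this] at hu

theorem eq_of_or_of_mul_mem_halfSpace (x : HNNExtension G A B φ) :
    (∃ g, x = of g) ∨ ∃ g u, of g * x ∈ halfSpace φ u := by
  obtain ⟨w, rfl⟩ := exists_reducedWord φ x
  obtain ⟨h, l, hl⟩ := w
  match l, hl with
  | [], _ => exact .inl ⟨h, by simp [ReducedWord.prod]⟩
  | (v, k) :: l, hl =>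
    exact .inr ⟨h⁻¹, v, of_mul_prod_mem_halfSpace ⟨h, (v, k) :: l, hl⟩ rfl⟩

theorem units_pow_mul_notMem_halfSpace {x : HNNExtension G A B φ} {u : ℤˣ}
    (hx : x ∈ halfSpace φ u) : t ^ (-(u : ℤ)) * x ∉ halfSpace φ (-u) := by
  obtain ⟨⟨h, l, hl⟩, hw, hu, rfl⟩ := hx
  obtain rfl : h = 1 := hw
  match l, hl, hu with
  | [], _, hu => simp at hu
  | (v, k) :: l, hl, hu =>
    obtain rfl : v = u := by simpa using hu
    rw [List.isChain_cons] at hl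
    rintro ⟨w', hw', hv, h⟩
    obtain ⟨h1, h2⟩ := ReducedWord.map_fst_eq_and_of_prod_eq φ
      (w₁ := w') (w₂ := ⟨k, l, hl.2⟩) (by rw [h]; simp [ReducedWord.prod, mul_assoc])
    have h3 := h2 (-v) (by simp [hv])
    rw [hw', inv_one, one_mul, neg_neg] at h3
    have h4 := congrArg List.head? h1
    rw [List.head?_map, List.head?_map, hv] at h4
    obtain ⟨y, hy, hy'⟩ := Option.map_eq_some_iff.1 h4.symm
    have := hl.1 y hy h3
    simp [hy'] at this

theorem units_pow_mul_mem_halfSpace {x : HNNExtension G A B φ} {u : ℤˣ}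
    (hx : x ∉ halfSpace φ u) : t ^ (-(u : ℤ)) * x ∈ halfSpace φ (-u) := by
  obtain ⟨w, rfl⟩ := exists_reducedWord φ x
  obtain ⟨h, l, hl⟩ := w
  by_cases hc : ((-u, h) :: l).IsChain (fun a b => a.2 ∈ toSubgroup A B a.1 → a.1 = b.1)
  · exact ⟨⟨1, (-u, h) :: l, hc⟩, rfl, rfl, by simp [ReducedWord.prod, mul_assoc]⟩
  · rw [List.isChain_cons] at hc
    simp only [hl, and_true, not_forall] at hc
    obtain ⟨y, hy, hh, hyu⟩ := hc
    have hyu' : y.1 = u := by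
      rcases Int.units_eq_one_or u with rfl | rfl <;>
        rcases Int.units_eq_one_or y.1 with h | h <;> simp_all
    have := of_mul_mem_halfSpace
      (of_mul_prod_mem_halfSpace (φ := φ) ⟨h, l, hl⟩ (u := u) (by
        rw [Option.mem_def] at hy; simp [hy, hyu'])) hh
    exact absurd (by simpa [← mul_assoc, ← map_mul] using this) hx

/-- The two sides of an edge: the complement of `halfSpace φ u` is the `t ^ u`-translate of
`halfSpace φ (-u)`. -/
theorem units_pow_mul_mem_halfSpace_iff {x : HNNExtension G A B φ} {u : ℤˣ} :
    t ^ (-(u : ℤ)) * x ∈ halfSpace φ (-u) ↔ x ∉ halfSpace φ u :=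
  ⟨fun h hx => units_pow_mul_notMem_halfSpace hx h, units_pow_mul_mem_halfSpace⟩

/-- Inverting reverses a word, so its last stable letter becomes the first, inverted. Induction from
the right end avoids handling reversed lists. -/
theorem of_mul_inv_prod_mem_halfSpace (h : G) (l : List (ℤˣ × G)) : ∀ (u : ℤˣ) (g : G)
    (hl : (l ++ [(u, g)]).IsChain (fun a b => a.2 ∈ toSubgroup A B a.1 → a.1 = b.1)),
    of g * (ReducedWord.prod φ ⟨h, l ++ [(u, g)], hl⟩)⁻¹ ∈ halfSpace φ (-u) := by
  induction l using List.reverseRecOn with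
  | nil =>
    intro u g hl
    have := units_pow_mul_mem_halfSpace (of_notMem_halfSpace (φ := φ) h⁻¹ u)
    simpa [ReducedWord.prod, mul_assoc] using this
  | append_singleton l p ih =>
    intro u g hl
    obtain ⟨v, k⟩ := p
    have hl' := (List.isChain_append.1 hl).1
    have := ih v k hl'
    have h2 : (ReducedWord.prod φ ⟨h, l ++ [(v, k)], hl'⟩)⁻¹ ∉ halfSpace φ u := by
      intro h3
      obtain ⟨rfl, h4⟩ := eq_and_mem_of_of_mul_mem h3 this
      rw [neg_neg] at h4
      have := (List.isChain_append.1 hl).2.2 (v, k) (by simp) (-v, g) (by simp) h4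
      simp at this
    simpa [ReducedWord.prod, mul_assoc] using units_pow_mul_mem_halfSpace h2

theorem prod_mul_prod_mem_halfSpace {u v : ℤˣ} {h g k : G} {l l' : List (ℤˣ × G)}
    (hh : h = 1)
    (hl : (l ++ [(v, g)]).IsChain (fun a b => a.2 ∈ toSubgroup A B a.1 → a.1 = b.1))
    (hu : (l ++ [(v, g)]).head?.map Prod.fst = some u)
    (hl' : l'.IsChain (fun a b => a.2 ∈ toSubgroup A B a.1 → a.1 = b.1))
    (hc : ∀ y ∈ l'.head?, g * k ∈ toSubgroup A B v → v = y.1) :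
    ReducedWord.prod φ ⟨h, l ++ [(v, g)], hl⟩ * ReducedWord.prod φ ⟨k, l', hl'⟩ ∈
      halfSpace φ u := by
  refine ⟨⟨1, l ++ (v, g * k) :: l', ?_⟩, rfl, ?_, by simp [ReducedWord.prod, hh, mul_assoc]⟩
  · rw [List.isChain_append] at hl ⊢
    refine ⟨hl.1, List.isChain_cons.2 ⟨hc, hl'⟩, fun x hx y hy => ?_⟩
    obtain rfl : y = (v, g * k) := by simpa using hy.symm
    exact hl.2.2 x hx (v, g) (by simp)
  · cases l <;> simpa using hu

theorem mul_of_mem_halfSpace {x : HNNExtension G A B φ} {u : ℤˣ} (hx : x ∈ halfSpace φ u)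
    (g : G) : x * of g ∈ halfSpace φ u := by
  obtain ⟨⟨h, l, hl⟩, hw, hu, rfl⟩ := hx
  obtain ⟨l, v, k, rfl⟩ := exists_snoc_of_head? hu
  simpa [ReducedWord.prod] using prod_mul_prod_mem_halfSpace (φ := φ) (k := g) (l' := []) hw hl hu
    (by simp) (by simp)

/-- The hypothesis on `y⁻¹` says that the translate of `halfSpace φ v` by `y` misses the base
vertex. A path from the base into it passes through `yG`, so it starts in the same direction as the
path to `yG`. In words: the product has no cancellation at the junction. -/
theorem mul_mem_halfSpace {x y : HNNExtension G A B φ} {u v : ℤˣ} (hy : y ∈ halfSpace φ u)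
    (hy' : y⁻¹ ∉ halfSpace φ v) (hx : x ∈ halfSpace φ v) : y * x ∈ halfSpace φ u := by
  obtain ⟨⟨h, l, hl⟩, hw, hu, rfl⟩ := hy
  obtain ⟨l, v', k, rfl⟩ := exists_snoc_of_head? hu
  obtain ⟨⟨h', l', hl'⟩, hw', hv, rfl⟩ := hx
  obtain rfl : h' = 1 := hw'
  refine prod_mul_prod_mem_halfSpace hw hl hu hl' fun p hp hk => ?_
  rw [Option.mem_def] at hp
  have hv' : p.1 = v := by simpa [hp] using hv
  rw [mul_one] at hk
  by_contra hne
  have hvv : v = -v' := by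
    rw [hv'] at hne
    rcases Int.units_eq_one_or v with rfl | rfl <;>
      rcases Int.units_eq_one_or v' with rfl | rfl <;> simp_all
  subst hvv
  have := of_mul_mem_halfSpace (of_mul_inv_prod_mem_halfSpace (φ := φ) h l v' k hl) (g := k⁻¹)
    (by rwa [neg_neg, inv_mem_iff])
  exact hy' (by simpa [← mul_assoc, ← map_mul] using this)

theorem units_pow_mem_halfSpace (u : ℤˣ) :
    (t ^ (u : ℤ) : HNNExtension G A B φ) ∈ halfSpace φ u :=
  ⟨⟨1, [(u, 1)], by simp⟩, rfl, rfl, by simp [ReducedWord.prod]⟩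

end HNNExtension

/-! ### The Powers property of HNN extensions -/

namespace HNNExtension

open NormalWord

variable {G : Type*} [Group G] {A B : Subgroup G} {φ : A ≃* B}

theorem eq_and_mem_of_mem_translate {x : HNNExtension G A B φ} {g h : G} {u v : ℤˣ}
    (hg : of g * x ∈ halfSpace φ u) (hh : of h * x ∈ halfSpace φ v) :
    u = v ∧ h * g⁻¹ ∈ toSubgroup A B (-u) :=
  eq_and_mem_of_of_mul_mem hg (by simpa [← mul_assoc] using hh)

theorem exists_notMem_toSubgroup (hA : A ≠ ⊤) (hB : B ≠ ⊤) (u : ℤˣ) :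
    ∃ g, g ∉ toSubgroup A B u := by
  have : toSubgroup A B u ≠ ⊤ := by
    rcases Int.units_eq_one_or u with rfl | rfl <;> assumption
  simpa [Subgroup.eq_top_iff'] using this

/-- As there are at least four directions at the base vertex, one of them avoids any three
given elements. -/
theorem exists_translate_halfSpace_avoiding (hA : A ≠ ⊤) (hB : B ≠ ⊤)
    (x : Fin 3 → HNNExtension G A B φ) :
    ∃ (s : G) (u : ℤˣ), ∀ k, of s⁻¹ * x k ∉ halfSpace φ u := by
  choose a ha using exists_notMem_toSubgroup hA hB
  by_contra! hcon
  -- Four directions: for each sign, the coset of `1` and that of an element outside the edge group.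
  -- If each contained one of three elements, two of them would share an element.
  choose k hk using fun i : ℤˣ × Bool =>
    hcon (if i.2 then 1 else a (-i.1)) i.1
  obtain ⟨i, j, hij, hkk⟩ := Fintype.exists_ne_map_eq_of_card_lt k (by simp)
  obtain ⟨u, p⟩ := i
  obtain ⟨v, q⟩ := j
  have hi := hk (u, p)
  have hj := hk (v, q)
  rw [← hkk] at hj
  obtain ⟨h1, h2⟩ := eq_and_mem_of_mem_translate hi hj
  dsimp only at h1
  subst h1
  have := ha (-u)
  cases p <;> cases q <;> simp_all

/-- Take a direction at the base that contains none of `y⁻¹`, `f`, `f⁻¹`. Avoiding `y⁻¹` puts its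
`y`-translate inside `halfSpace φ v`. Avoiding `f⁻¹` puts its `f`-translate into the direction of
`fG`, and avoiding `f` makes that a different direction. -/
theorem exists_disjoint_translate_halfSpace (hA : A ≠ ⊤) (hB : B ≠ ⊤)
    {y f : HNNExtension G A B φ} {v : ℤˣ} (hy : y ∈ halfSpace φ v)
    (hf : f ∉ (of : G →* HNNExtension G A B φ).range) :
    ∃ (s : G) (u : ℤˣ), (∀ x ∈ halfSpace φ u, y * of s * x ∈ halfSpace φ v) ∧
      ∀ x ∈ halfSpace φ u, of s⁻¹ * f * of s * x ∉ halfSpace φ u := by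
  obtain ⟨s, u, hs⟩ := exists_translate_halfSpace_avoiding hA hB ![y⁻¹, f, f⁻¹]
  have h0 := hs 0
  have h1 := hs 1
  have h2 := hs 2
  simp only [Matrix.cons_val] at h0 h1 h2
  refine ⟨s, u, fun x hx => mul_mem_halfSpace (mul_of_mem_halfSpace hy s) ?_ hx, fun x hx hfx => ?_⟩
  · simpa using h0
  · rcases eq_of_or_of_mul_mem_halfSpace (of s⁻¹ * f * of s) with ⟨g, hg⟩ | ⟨g, w, hg⟩
    · refine hf ⟨s * g * s⁻¹, ?_⟩
      rw [map_mul, map_mul, ← hg]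
      simp [mul_assoc]
    · have h3 := mul_mem_halfSpace hg (v := u) (fun h => h2 (by
        simpa [mul_assoc] using mul_of_mem_halfSpace h (g * s⁻¹))) hx
      rw [mul_assoc] at h3
      obtain ⟨rfl, hgu⟩ := eq_and_mem_of_of_mul_mem hfx h3
      exact h1 (by simpa [← mul_assoc] using
        mul_of_mem_halfSpace (of_mul_mem_halfSpace hg (inv_mem hgu)) s⁻¹)

theorem units_pow_nat_mem_halfSpace (u : ℤˣ) (m : ℕ) :
    ((t ^ (u : ℤ)) ^ (m + 1) : HNNExtension G A B φ) ∈ halfSpace φ u := by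
  induction m with
  | zero => simpa using units_pow_mem_halfSpace u
  | succ m ih =>
    rw [pow_succ']
    refine mul_mem_halfSpace (units_pow_mem_halfSpace u) (fun h => ?_) ih
    have h1 : (t ^ ((-u : ℤˣ) : ℤ) : HNNExtension G A B φ) ∈ halfSpace φ (-u) :=
      units_pow_mem_halfSpace (-u)
    have := (eq_and_mem_of_of_mul_mem (g := 1) h1 (by simpa using h)).1
    simp at this

/-- The direction `b · halfSpace φ u` differs from `halfSpace φ u`, so negative powers of `t ^ u`
carry it into `halfSpace φ (-u)`, which it does not meet. -/
theorem disjoint_units_pow_mul_halfSpace {u : ℤˣ} {b : G} (hb : b ∉ toSubgroup A B (-u))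
    (m : ℕ) {x y : HNNExtension G A B φ} (hx : x ∈ halfSpace φ u) (hy : y ∈ halfSpace φ u) :
    of b * x ≠ (t ^ ((-u : ℤˣ) : ℤ)) ^ (m + 1) * of b * y := by
  intro h
  have h1 : (t ^ ((-u : ℤˣ) : ℤ)) ^ (m + 1) * of b * y ∈ halfSpace φ (-u) := by
    refine mul_mem_halfSpace (mul_of_mem_halfSpace (units_pow_nat_mem_halfSpace (-u) m) b)
      (fun h2 => hb ?_) hy
    have h3 := units_pow_nat_mem_halfSpace (φ := φ) u m
    simpa using (eq_and_mem_of_of_mul_mem h3 (g := b⁻¹) (v := u) (by simpa using h2)).2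
  rw [← h] at h1
  have := (eq_and_mem_of_of_mul_mem hx h1).1
  rcases Int.units_eq_one_or u with rfl | rfl <;> simp at this

/-- An HNN extension that is not ascending is a Powers group if no nontrivial element fixes a
half-tree of its Bass–Serre tree. -/
theorem isPowersGroup_of_halfSpace (hA : A ≠ ⊤) (hB : B ≠ ⊤)
    (hfix : ∀ (u : ℤˣ) (f : HNNExtension G A B φ),
      (∀ x ∈ halfSpace φ u, x⁻¹ * f * x ∈ (of : G →* HNNExtension G A B φ).range) → f = 1) :
    IsPowersGroup (HNNExtension G A B φ) := by
  intro F hne hF N _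
  clear hne
  -- A half-tree disjoint from all its translates by `F`. Each new `f` moves some vertex of the
  -- current half-tree, and a smaller one beyond that vertex handles `f` too; the earlier elements
  -- remain handled because it is smaller.
  obtain ⟨z, v, hz⟩ : ∃ (z : HNNExtension G A B φ) (v : ℤˣ), ∀ f ∈ F, ∀ x ∈ halfSpace φ v,
      z⁻¹ * f * z * x ∉ halfSpace φ v := by
    classical
    induction F using Finset.induction_on with
    | empty => exact ⟨1, 1, by simp⟩
    | insert f F _ ih =>
      rw [Finset.mem_insert, not_or] at hF
      obtain ⟨z, v, hz⟩ := ih hF.2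
      obtain ⟨y, hy, hfy⟩ : ∃ y ∈ halfSpace φ v,
          y⁻¹ * (z⁻¹ * f * z) * y ∉ (of : G →* HNNExtension G A B φ).range := by
        by_contra! h
        have := hfix v _ h
        exact hF.1 (by simpa [mul_assoc, inv_mul_eq_one, eq_comm] using this)
      obtain ⟨s, u, h1, h2⟩ := exists_disjoint_translate_halfSpace hA hB hy hfy
      refine ⟨z * (y * of s), u, fun f' hf' x hx hx' => ?_⟩
      rcases Finset.mem_insert.1 hf' with rfl | hf'
      · exact h2 x hx (by simpa [mul_assoc] using hx')
      · exact hz f' hf' _ (h1 x hx) (by simpa [mul_assoc] using h1 _ hx')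
  obtain ⟨b, hb⟩ := exists_notMem_toSubgroup hA hB (-(-v))
  have hD : ∀ x ∈ (z • halfSpace φ v)ᶜ, t ^ (-(v : ℤ)) * (z⁻¹ * x) ∈ halfSpace φ (-v) := by
    intro x hx
    rw [Set.mem_compl_iff, Set.mem_smul_set_iff_inv_smul_mem] at hx
    exact units_pow_mul_mem_halfSpace hx
  have key : ∀ j k : ℕ, j < k → ∀ x ∈ (z • halfSpace φ v)ᶜ, ∀ y ∈ (z • halfSpace φ v)ᶜ,
      (t ^ ((-(-v) : ℤˣ) : ℤ)) ^ j * of b * t ^ (-(v : ℤ)) * z⁻¹ * x ≠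
        (t ^ ((-(-v) : ℤˣ) : ℤ)) ^ k * of b * t ^ (-(v : ℤ)) * z⁻¹ * y := by
    intro j k hjk x hx y hy h
    obtain ⟨m, rfl⟩ := Nat.exists_eq_add_of_lt hjk
    refine disjoint_units_pow_mul_halfSpace hb m (hD x hx) (hD y hy) ?_
    rw [add_assoc, pow_add] at h
    simpa [mul_assoc] using h
  -- The factor `t ^ (-v) * z⁻¹` carries the complement onto `halfSpace φ (-v)`; `b` turns it into
  -- another direction, and the powers of `t ^ v` then spread it out.
  refine ⟨z • halfSpace φ v, (z • halfSpace φ v)ᶜ,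
    fun j => (t ^ ((-(-v) : ℤˣ) : ℤ)) ^ (j : ℕ) * of b * t ^ (-(v : ℤ)) * z⁻¹,
    Set.union_compl_self _, Set.inter_compl_self _, fun f hf => ?_, fun j k hjk => ?_⟩
  · rw [Set.eq_empty_iff_forall_notMem]
    rintro _ ⟨⟨_, ⟨x, hx, rfl⟩, rfl⟩, y, hy, h⟩
    refine hz f hf x hx ?_
    simp only [smul_eq_mul] at h
    rw [mul_assoc, mul_assoc, ← h]
    simpa using hy
  · rw [Set.eq_empty_iff_forall_notMem]
    rintro _ ⟨⟨x, hx, rfl⟩, y, hy, h⟩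
    simp only [smul_eq_mul] at h
    rcases lt_or_gt_of_ne (Fin.val_ne_of_ne hjk) with hlt | hlt
    · exact key j k hlt x hx y hy h.symm
    · exact key k j hlt y hy x hx h

end HNNExtension

/-- Powers groups are icc. -/
theorem IsPowersGroup.isICC {Γ : Type*} [Group Γ] (h : IsPowersGroup Γ) : IsICC Γ := by
  intro g hg hfin
  obtain ⟨C, D, γ, hCD, -, hC, hD⟩ := h hfin.toFinset ⟨g, by simpa using ⟨1, by simp⟩⟩
    (by
      rw [Set.Finite.mem_toFinset]
      rintro ⟨c, hc⟩
      exact hg (by simpa [eq_comm, mul_inv_eq_one] using hc)) 3 (by norm_num)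
  have hD' : ∀ j k x, j ≠ k → x ∈ γ j • D → x ∉ γ k • D := fun j k x hjk h1 h2 =>
    (Set.eq_empty_iff_forall_notMem.1 (hD j k hjk)) x ⟨h1, h2⟩
  -- Otherwise `(γ j)⁻¹` and `(γ j)⁻¹ * g` both lie in `C`, although the conjugate `(γ j)⁻¹ * g * γ
  -- j` maps the first to the second. Three disjoint sets cannot each contain one of the two points
  -- `1` and `g`.
  have hC' : ∀ j, (1 : Γ) ∈ γ j • D ∨ g ∈ γ j • D := by
    intro j
    by_contra! h
    have h1 : ∀ x, x ∉ γ j • D → (γ j)⁻¹ * x ∈ C := by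
      intro x hx
      rw [Set.mem_smul_set_iff_inv_smul_mem] at hx
      exact ((Set.ext_iff.1 hCD ((γ j)⁻¹ * x)).2 trivial).resolve_right hx
    refine (Set.eq_empty_iff_forall_notMem.1
      (hC ((γ j)⁻¹ * g * γ j) (by simpa using ⟨(γ j)⁻¹, by simp⟩))) ((γ j)⁻¹ * g)
      ⟨⟨_, h1 1 h.1, by simp⟩, h1 g h.2⟩
  rcases hC' 0 with h0 | h0 <;> rcases hC' 1 with h1 | h1 <;> rcases hC' 2 with h2 | h2 <;>
    first
    | exact hD' 0 1 _ (by decide) h0 h1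
    | exact hD' 0 2 _ (by decide) h0 h2
    | exact hD' 1 2 _ (by decide) h1 h2

/-! ### Kernel and quasi-kernels of an HNN extension -/

namespace HNN

open HNNExtension HNNExtension.NormalWord

variable {G : Type*} [Group G] {H : Subgroup G} {θ : H →* G} {hθ : Function.Injective θ}

/-! ### Normal forms and reduced words -/

theorem toSubgroup_eq_assoc (u : ℤˣ) : toSubgroup H θ.range u = assoc θ (-u) := by
  rcases Int.units_eq_one_or u with rfl | rfl <;> simp [assoc]

theorem stable_zpow (n : ℤ) : stable θ hθ ^ n = t ^ (-n) := by
  rw [stable, inv_zpow, zpow_neg]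

/-- The letters of a normal form, as those of a reduced word followed by an element of `G`. -/
theorem NormalForm.exists_reducedWord {S : ℤˣ → Set G} (hS : IsTransversal θ S) (g : G) :
    ∀ (l : List (G × ℤˣ)) (_ : ∀ p ∈ l, p.1 ∈ S (-p.2))
      (_ : l.IsChain (fun p q => q.1 = 1 → p.2 = q.2)),
      ∃ w : ReducedWord G H θ.range,
        w.prod (MonoidHom.ofInjective hθ) =
          (l.map fun p => of p.1 * stable θ hθ ^ (p.2 : ℤ)).prod * of g ∧
        w.toList.head?.map Prod.fst = l.head?.map (fun p => -p.2) ∧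
        ∀ p ∈ l.head?, w.head = p.1
  | [], _, _ => ⟨⟨g, [], by simp⟩, by simp [ReducedWord.prod], rfl, by simp⟩
  | (a, e) :: l, hm, hc => by
    rw [List.isChain_cons] at hc
    obtain ⟨w, hw, hh, hf⟩ := exists_reducedWord hS g l (fun p hp => hm p (by simp [hp])) hc.2
    refine ⟨⟨a, (-e, w.head) :: w.toList, ?_⟩, ?_, rfl, by simp⟩
    · refine List.isChain_cons.2 ⟨fun y hy hmem => ?_, w.chain⟩
      rw [Option.mem_def] at hy
      rw [hy] at hh
      obtain ⟨p, hp, hpy⟩ := Option.map_eq_some_iff.1 hh.symm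
      dsimp only at hmem hpy ⊢
      rw [← hpy]
      by_contra hne
      have hpe : -p.2 = e := by
        rcases Int.units_eq_one_or p.2 with h | h <;>
          rcases Int.units_eq_one_or e with h' | h' <;> simp_all
      have hpS := hm p (List.mem_cons_of_mem _ (List.mem_of_mem_head? hp))
      rw [hpe] at hpS
      rw [hf p hp, toSubgroup_eq_assoc, neg_neg] at hmem
      -- The only representative that lies in the subgroup itself is `1`, so a cancellation in the
      -- word would violate the normal form condition.
      have h1 : p.1 = 1 := ((hS e).2 p.1).unique ⟨hpS, by simp⟩
        ⟨(hS e).1, by simpa using hmem⟩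
      exact hne (congrArg _ (hc.1 p hp h1))
    · simp only [List.map_cons, List.prod_cons]
      rw [mul_assoc, ← hw]
      simp [ReducedWord.prod, mul_assoc, stable_zpow]

/-- Going along the word, each letter is split into its representative and a subgroup element, which
is moved past the stable letter into the next letter. -/
theorem exists_normalForm {S : ℤˣ → Set G} (hS : IsTransversal θ S) :
    ∀ (l : List (ℤˣ × G)) (h : G)
      (hl : l.IsChain (fun a b => a.2 ∈ toSubgroup H θ.range a.1 → a.1 = b.1)),
      ∃ w : NormalForm S,
        w.value θ hθ = ReducedWord.prod (MonoidHom.ofInjective hθ) ⟨h, l, hl⟩ ∧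
        w.letters.head?.map Prod.snd = l.head?.map (fun p => -p.1) ∧
        ∀ p ∈ w.letters.head?, p.1⁻¹ * h ∈ assoc θ (-p.2)
  | [], h, _ => ⟨⟨[], h, by simp, by simp⟩, by simp [NormalForm.value, ReducedWord.prod], rfl,
      by simp⟩
  | (u, g) :: l, h, hl => by
    obtain ⟨s, ⟨hs, hsh⟩, -⟩ := (hS u).2 h
    obtain ⟨b, hb, hbt⟩ := exists_of_mul_units_pow (MonoidHom.ofInjective hθ) u
      (a := s⁻¹ * h) (by rwa [toSubgroup_eq_assoc, neg_neg])
    have hl' := List.isChain_cons.1 hl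
    obtain ⟨w, hw, hh, hf⟩ := exists_normalForm hS l (b * g) hl'.2
    have hm : ∀ p ∈ (s, -u) :: w.letters, p.1 ∈ S (-p.2) := by
      intro p hp
      rcases List.mem_cons.1 hp with rfl | hp
      · simpa using hs
      · exact w.mem p hp
    have hc : ((s, -u) :: w.letters).IsChain (fun p q => q.1 = 1 → p.2 = q.2) := by
      refine List.isChain_cons.2 ⟨fun p hp h1 => ?_, w.chain⟩
      have h2 := hf p hp
      rw [Option.mem_def] at hp
      rw [hp] at hh
      obtain ⟨q, hq, hqp⟩ := Option.map_eq_some_iff.1 hh.symm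
      dsimp only at hqp ⊢
      rw [h1, inv_one, one_mul, ← hqp, neg_neg] at h2
      rw [← hqp]
      by_contra hne
      have huq : q.1 = -u := by
        rcases Int.units_eq_one_or q.1 with h | h <;>
          rcases Int.units_eq_one_or u with h' | h' <;> simp_all
      rw [huq, ← toSubgroup_eq_assoc, Subgroup.mul_mem_cancel_left _ hb] at h2
      exact hne (by rw [← hl'.1 q hq h2])
    refine ⟨⟨(s, -u) :: w.letters, w.endLetter, hm, hc⟩, ?_, rfl, by simpa using hsh⟩
    have h2 : NormalForm.value θ hθ ⟨(s, -u) :: w.letters, w.endLetter, hm, hc⟩ =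
        of s * t ^ (u : ℤ) * w.value θ hθ := by
      simp [NormalForm.value, stable_zpow, mul_assoc]
    have h3 : of h * t ^ (u : ℤ) = of s * t ^ (u : ℤ) * (of b : Ext θ hθ) := by
      rw [mul_assoc, ← hbt, ← mul_assoc, ← map_mul, mul_inv_cancel_left]
    rw [h2, hw]
    simp only [ReducedWord.prod, List.map_cons, List.prod_cons, map_mul]
    simp only [← mul_assoc]
    rw [h3]

/-- The sign changes because `τ = t⁻¹`. -/
theorem typeDagger_eq_halfSpace {S : ℤˣ → Set G} (hS : IsTransversal θ S) (ε : ℤˣ) :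
    typeDagger θ hθ S ε = halfSpace (MonoidHom.ofInjective hθ) (-ε) := by
  ext x
  constructor
  · rintro ⟨w, rfl, hw⟩
    obtain ⟨w', h1, h2, h3⟩ :=
      NormalForm.exists_reducedWord (hθ := hθ) hS w.endLetter w.letters w.mem w.chain
    exact ⟨w', h3 _ hw, by rw [h2, hw]; rfl, h1⟩
  · rintro ⟨⟨h, l, hl⟩, hw, hu, rfl⟩
    obtain rfl : h = 1 := hw
    obtain ⟨w, h1, h2, h3⟩ := exists_normalForm (hθ := hθ) hS l 1 hl
    refine ⟨w, h1, ?_⟩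
    dsimp only at hu
    obtain ⟨q, hq, hqu⟩ := Option.map_eq_some_iff.1 hu
    rw [hq] at h2
    obtain ⟨p, hp, hpq⟩ := Option.map_eq_some_iff.1 h2
    have h4 := h3 p hp
    have hpε : p.2 = ε := by simp [hpq, hqu]
    have h5 : p.1 = 1 := ((hS (-p.2)).2 1).unique
      ⟨w.mem p (List.mem_of_mem_head? hp), h4⟩ ⟨(hS _).1, by simp⟩
    rw [hp, ← h5, ← hpε]

/-! ### Quasi-kernels as pointwise stabilizers of half-trees -/

theorem mem_conjBase {r x : Ext θ hθ} :
    x ∈ conjBase θ hθ r ↔ ∃ h ∈ H, of h = r⁻¹ * x * r := by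
  simp only [conjBase, Subgroup.mem_map, MulEquiv.coe_toMonoidHom, MulAut.conj_apply,
    exists_exists_and_eq_and]
  refine exists_congr fun h => and_congr_right fun _ => ?_
  rw [mul_inv_eq_iff_eq_mul, mul_assoc, eq_inv_mul_iff_mul_eq]

theorem mem_kernel {x : Ext θ hθ} :
    x ∈ kernel θ hθ ↔ ∀ r : Ext θ hθ, ∃ h ∈ H, of h = r⁻¹ * x * r := by
  simp only [kernel, Subgroup.mem_iInf, mem_conjBase]

theorem mem_quasiKernel {S : ℤˣ → Set G} (hS : IsTransversal θ S) {ε : ℤˣ} {x : Ext θ hθ} :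
    x ∈ quasiKernel θ hθ S ε ↔ ∀ r ∉ halfSpace (MonoidHom.ofInjective hθ) (-ε),
      ∃ h ∈ H, of h = r⁻¹ * x * r := by
  simp only [quasiKernel, Subgroup.mem_iInf, mem_conjBase, typeDagger_eq_halfSpace hS,
    Set.mem_compl_iff]

theorem kernel_le_quasiKernel (S : ℤˣ → Set G) (ε : ℤˣ) :
    kernel θ hθ ≤ quasiKernel θ hθ S ε :=
  le_iInf₂ fun r _ => iInf_le _ r

instance normal_kernel : (kernel θ hθ).Normal := by
  refine ⟨fun x hx g => mem_kernel.2 fun r => ?_⟩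
  obtain ⟨h, hh, hx⟩ := mem_kernel.1 hx (g⁻¹ * r)
  exact ⟨h, hh, by simpa [mul_assoc] using hx⟩

theorem mem_base_of_of_eq_conj {a b : G}
    (h : (of b : Ext θ hθ) = t * of a * t⁻¹) : a ∈ H := by
  have h1 : (t⁻¹ : Ext θ hθ) ∈ halfSpace (MonoidHom.ofInjective hθ) (-1) := by
    simpa using units_pow_mem_halfSpace (φ := MonoidHom.ofInjective hθ) (-1)
  have h2 : of a * (t⁻¹ : Ext θ hθ) = t⁻¹ * of b := by rw [h]; group
  have h3 := eq_and_mem_of_of_mul_mem h1 (h2 ▸ mul_of_mem_halfSpace h1 b)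
  simpa using h3.2

theorem exists_range_eq_of_inv_conj {a : H} {s x : Ext θ hθ}
    (h : of (a : G) = (s * t)⁻¹ * x * (s * t)) :
    of (θ a) = s⁻¹ * x * s := by
  have := equiv_eq_conj (φ := MonoidHom.ofInjective hθ) a
  rw [h] at this
  refine this.trans ?_
  group

/-- For `s` outside `θ(H)`, neither `s` nor `s * t` lies in the excluded half-tree. Conjugation by
`s⁻¹` therefore maps `K_ε` into both `H` and `t H t⁻¹ = θ(H)`. -/
theorem finite_quasiKernel (hna : NonAscending θ)
    (hfin : ((H : Set G) ∩ (θ.range : Set G)).Finite)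
    {S : ℤˣ → Set G} (hS : IsTransversal θ S) (ε : ℤˣ) :
    Finite (quasiKernel θ hθ S ε) := by
  obtain ⟨s, hs⟩ := exists_notMem_toSubgroup (A := H) (B := θ.range) hna.1 hna.2 (-1)
  refine Set.Finite.subset
    ((hfin.image (of : G → Ext θ hθ)).preimage (f := fun x => (of s)⁻¹ * x * of s) ?_) ?_
  · intro x _ y _ h
    simpa using h
  · intro x hx
    rw [SetLike.mem_coe, mem_quasiKernel hS] at hx
    obtain ⟨h, hh, h1⟩ := hx (of s) (of_notMem_halfSpace _ _)
    obtain ⟨k, hk, h2⟩ := hx (of s * t) (fun hmem => hs (by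
      have h0 : (t : Ext θ hθ) ∈ halfSpace (MonoidHom.ofInjective hθ) 1 := by
        simpa using units_pow_mem_halfSpace (φ := MonoidHom.ofInjective hθ) 1
      exact (eq_and_mem_of_of_mul_mem h0 hmem).2))
    have h3 := exists_range_eq_of_inv_conj (a := ⟨k, hk⟩) h2
    refine ⟨h, ⟨hh, ⟨k, hk⟩, ?_⟩, h1⟩
    exact of_injective (MonoidHom.ofInjective hθ) (h3.trans h1.symm)

theorem finite_kernel (hna : NonAscending θ)
    (hfin : ((H : Set G) ∩ (θ.range : Set G)).Finite)
    {S : ℤˣ → Set G} (hS : IsTransversal θ S) : Finite (kernel θ hθ) :=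
  have := finite_quasiKernel (hθ := hθ) hna hfin hS 1
  Finite.of_injective _ (Subgroup.inclusion_injective (kernel_le_quasiKernel S 1))

theorem normalizer_eq_top_of_mem {K : Subgroup (Ext θ hθ)} {u : ℤˣ}
    (h : ∀ s : G, t ^ (u : ℤ) * of s ∈ Subgroup.normalizer (K : Set (Ext θ hθ))) :
    Subgroup.normalizer (K : Set (Ext θ hθ)) = ⊤ := by
  have h1 : t ^ (u : ℤ) ∈ Subgroup.normalizer (K : Set (Ext θ hθ)) := by simpa using h 1
  refine (Subgroup.eq_top_iff' _).2 fun x => ?_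
  induction x using HNNExtension.induction_on with
  | of g => exact (Subgroup.mul_mem_cancel_left _ h1).1 (h g)
  | t => rcases Int.units_eq_one_or u with rfl | rfl <;> simpa using h1
  | mul x y hx hy => exact mul_mem hx hy
  | inv x hx => exact inv_mem hx

/-- The elements `g = t ^ (-ε) * s` map the excluded half-tree into itself, so `g⁻¹` preserves its
complement and `g K g⁻¹ ≤ K`. Finiteness turns this into normalization; a normal subgroup inside `H`
lies in the kernel. -/
theorem quasiKernel_le_kernel (hna : NonAscending θ)
    (hfin : ((H : Set G) ∩ (θ.range : Set G)).Finite)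
    {S : ℤˣ → Set G} (hS : IsTransversal θ S) (ε : ℤˣ) :
    quasiKernel θ hθ S ε ≤ kernel θ hθ := by
  have := finite_quasiKernel (hθ := hθ) hna hfin hS ε
  have hn : Subgroup.normalizer (quasiKernel θ hθ S ε : Set (Ext θ hθ)) = ⊤ := by
    refine normalizer_eq_top_of_mem (u := -ε) fun s => ?_
    refine Subgroup.mem_normalizer_fintype fun x hx => ?_
    rw [SetLike.mem_coe, mem_quasiKernel hS] at hx ⊢
    intro r hr
    obtain ⟨h, hh, hx⟩ := hx ((t ^ ((-ε : ℤˣ) : ℤ) * of s)⁻¹ * r) (fun hmem => hr (by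
      have h1 := mul_of_mem_halfSpace
        (units_pow_mem_halfSpace (φ := MonoidHom.ofInjective hθ) (-ε)) s
      refine mul_inv_cancel_left (t ^ ((-ε : ℤˣ) : ℤ) * of s) r ▸
        mul_mem_halfSpace h1 (fun h2 => ?_) hmem
      have h3 := units_pow_mem_halfSpace (φ := MonoidHom.ofInjective hθ) ε
      have h4 := (eq_and_mem_of_of_mul_mem h3 (g := s⁻¹) (v := -ε) (by simpa using h2)).1
      rcases Int.units_eq_one_or ε with rfl | rfl <;> simp at h4))
    exact ⟨h, hh, by simpa [mul_assoc] using hx⟩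
  intro x hx
  refine mem_kernel.2 fun r => ?_
  have hr : r⁻¹ ∈ Subgroup.normalizer (quasiKernel θ hθ S ε : Set (Ext θ hθ)) :=
    hn ▸ Subgroup.mem_top _
  have h1 := (Subgroup.mem_normalizer_iff.1 hr x).1 hx
  have h2 := (mem_quasiKernel hS).1 h1 (of 1) (of_notMem_halfSpace _ _)
  simpa using h2

/-- An element that fixes a half-tree pointwise is conjugate into a quasi-kernel. -/
theorem mem_quasiKernel_of_forall_mem_range {S : ℤˣ → Set G} (hS : IsTransversal θ S) {ε : ℤˣ}
    {f : Ext θ hθ} (hf : ∀ q ∉ halfSpace (MonoidHom.ofInjective hθ) (-ε),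
      q⁻¹ * f * q ∈ (of : G →* Ext θ hθ).range) : f ∈ quasiKernel θ hθ S ε := by
  refine (mem_quasiKernel hS).2 fun q hq => ?_
  have ht : (t : Ext θ hθ) ∈ halfSpace (MonoidHom.ofInjective hθ) 1 := by
    simpa using units_pow_mem_halfSpace (φ := MonoidHom.ofInjective hθ) 1
  have ht' : (t⁻¹ : Ext θ hθ) ∈ halfSpace (MonoidHom.ofInjective hθ) (-1) := by
    simpa using units_pow_mem_halfSpace (φ := MonoidHom.ofInjective hθ) (-1)
  obtain ⟨a, ha⟩ := hf q hq
  refine ⟨a, ?_, ha⟩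
  -- `H` stabilizes the edge from `G` to `t⁻¹G`, so the claim is that `f` fixes the edge from `qG`
  -- to `q t⁻¹ G`. This is clear if both ends lie in the fixed half-tree. Otherwise the edge is the
  -- bounding one, which forces `q ∈ G` and `ε = 1`.
  by_cases hqt : q * t⁻¹ ∈ halfSpace (MonoidHom.ofInjective hθ) (-ε)
  · have h1 : q⁻¹ ∉ halfSpace (MonoidHom.ofInjective hθ) (-1) := by
      rw [← units_pow_mul_mem_halfSpace_iff]
      by_contra h
      refine hq ?_
      have := mul_mem_halfSpace hqt (v := 1) (by simpa using h) ht
      simpa using this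
    rcases eq_of_or_of_mul_mem_halfSpace q with ⟨g, rfl⟩ | ⟨g, w, hg⟩
    · obtain ⟨hε, hgH⟩ := eq_and_mem_of_of_mul_mem ht' hqt
      obtain rfl : ε = 1 := by
        rcases Int.units_eq_one_or ε with h | h
        · exact h
        · simp [h] at hε
      simp only [neg_neg, toSubgroup_one] at hgH
      have hfa : f = of (g * a * g⁻¹) := by
        rw [map_mul, map_mul, ha, map_inv]; group
      -- If `f` moved the bounding edge, the image of its far end would lie in the fixed half-tree;
      -- being fixed by `f`, it would equal the end itself.
      by_contra hna
      have hna' : g * a * g⁻¹ ∉ H := fun h => hna (by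
        simpa [mul_assoc] using mul_mem (mul_mem (inv_mem hgH) h) hgH)
      obtain ⟨b, hb⟩ := hf (of (g * a * g⁻¹) * t⁻¹) (fun h => hna' (by
        simpa using (eq_and_mem_of_of_mul_mem ht' h).2))
      refine hna' (mem_base_of_of_eq_conj (hθ := hθ) (b := b) ?_)
      rw [hb, hfa]
      group
    · exfalso
      have h2 := mul_mem_halfSpace hg (v := -1)
        (fun h => h1 (by simpa [mul_assoc] using mul_of_mem_halfSpace h g)) ht'
      rw [mul_assoc] at h2
      obtain ⟨rfl, h3⟩ := eq_and_mem_of_of_mul_mem hqt h2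
      exact hq (by simpa [← mul_assoc, ← map_mul] using of_mul_mem_halfSpace hg (inv_mem h3))
  · obtain ⟨b, hb⟩ := hf _ hqt
    refine mem_base_of_of_eq_conj (hθ := hθ) (b := b) ?_
    rw [hb, ha]
    group

theorem isPowersGroup_of_kernel_eq_bot (hna : NonAscending θ)
    (hfin : ((H : Set G) ∩ (θ.range : Set G)).Finite)
    {S : ℤˣ → Set G} (hS : IsTransversal θ S) (hker : kernel θ hθ = ⊥) :
    IsPowersGroup (Ext θ hθ) := by
  refine isPowersGroup_of_halfSpace hna.1 hna.2 fun u f hf => ?_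
  -- Conjugation by `t ^ u` turns the fixed half-tree into the complement of `halfSpace (-u)`.
  have h1 : (t ^ (u : ℤ))⁻¹ * f * t ^ (u : ℤ) ∈ quasiKernel θ hθ S u := by
    refine mem_quasiKernel_of_forall_mem_range hS fun q hq => ?_
    have := hf (t ^ (u : ℤ) * q) (by
      simpa using units_pow_mul_mem_halfSpace hq)
    simpa [mul_assoc] using this
  have h2 := quasiKernel_le_kernel hna hfin hS u h1
  rw [hker, Subgroup.mem_bot] at h2
  simpa [mul_assoc, inv_mul_eq_one, eq_comm] using h2

end HNN

/-! ### Functions in `ℓ²(Γ)` and their restrictions to subsets of `Γ` -/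

section Restriction

variable {Γ : Type*}

theorem memlp_indicator (D : Set Γ) (ξ : EllTwo Γ) : Memℓp (D.indicator ξ) 2 := by
  refine (lp.memℓp ξ).mono' fun g => ?_
  by_cases h : g ∈ D <;> simp [h]

/-- The function that agrees with `ξ` on `D` and vanishes off `D`. -/
noncomputable def ellTwoIndicator (D : Set Γ) (ξ : EllTwo Γ) : EllTwo Γ :=
  ⟨D.indicator ξ, memlp_indicator D ξ⟩

theorem ellTwoIndicator_apply (D : Set Γ) (ξ : EllTwo Γ) (g : Γ) :
    ellTwoIndicator D ξ g = D.indicator ξ g := rfl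

theorem ellTwoIndicator_add_compl (D : Set Γ) (ξ : EllTwo Γ) :
    ellTwoIndicator D ξ + ellTwoIndicator Dᶜ ξ = ξ := by
  ext g
  by_cases h : g ∈ D <;> simp [ellTwoIndicator_apply, h]

theorem ellTwoIndicator_add (D : Set Γ) (ξ η : EllTwo Γ) :
    ellTwoIndicator D (ξ + η) = ellTwoIndicator D ξ + ellTwoIndicator D η :=
  Subtype.ext (Set.indicator_add D ξ η)

/-- Restriction to `D` is an orthogonal projection; the norm bounds below follow from this by
Cauchy–Schwarz. -/
theorem inner_ellTwoIndicator_self (D : Set Γ) (ξ : EllTwo Γ) :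
    inner ℂ ξ (ellTwoIndicator D ξ) = ((‖ellTwoIndicator D ξ‖ ^ 2 : ℝ) : ℂ) := by
  have : inner ℂ ξ (ellTwoIndicator D ξ) =
      inner ℂ (ellTwoIndicator D ξ) (ellTwoIndicator D ξ) := by
    rw [lp.inner_eq_tsum, lp.inner_eq_tsum]
    refine tsum_congr fun g => ?_
    by_cases h : g ∈ D <;> simp [ellTwoIndicator_apply, h]
  rw [this, inner_self_eq_norm_sq_to_K]
  norm_cast

theorem inner_ellTwoIndicator_of_disjoint {D E : Set Γ} (h : Disjoint D E) (ξ η : EllTwo Γ) :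
    inner ℂ (ellTwoIndicator D ξ) (ellTwoIndicator E η) = 0 := by
  rw [lp.inner_eq_tsum]
  refine (tsum_congr fun g => ?_).trans tsum_zero
  by_cases hg : g ∈ D
  · simp [ellTwoIndicator_apply, Set.disjoint_left.1 h hg]
  · simp [ellTwoIndicator_apply, hg]

theorem norm_ellTwoIndicator_le (D : Set Γ) (ξ : EllTwo Γ) : ‖ellTwoIndicator D ξ‖ ≤ ‖ξ‖ := by
  have h := norm_inner_le_norm (𝕜 := ℂ) ξ (ellTwoIndicator D ξ)
  rw [inner_ellTwoIndicator_self, Complex.norm_real, Real.norm_of_nonneg (sq_nonneg _)] at h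
  by_contra! hlt
  nlinarith [norm_nonneg ξ]

theorem norm_sq_sum_ellTwoIndicator {ι : Type*} [Fintype ι] {D : ι → Set Γ}
    (hD : Pairwise fun i j => Disjoint (D i) (D j)) (η : ι → EllTwo Γ) :
    ‖∑ i, ellTwoIndicator (D i) (η i)‖ ^ 2 = ∑ i, ‖ellTwoIndicator (D i) (η i)‖ ^ 2 := by
  have : (((‖∑ i, ellTwoIndicator (D i) (η i)‖ ^ 2 : ℝ)) : ℂ) =
      ((∑ i, ‖ellTwoIndicator (D i) (η i)‖ ^ 2 : ℝ) : ℂ) := by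
    have h := inner_self_eq_norm_sq_to_K (𝕜 := ℂ) (∑ i, ellTwoIndicator (D i) (η i))
    push_cast
    refine h.symm.trans ?_
    rw [sum_inner]
    refine Finset.sum_congr rfl fun i _ => ?_
    rw [inner_sum, Finset.sum_eq_single i
      (fun j _ hj => inner_ellTwoIndicator_of_disjoint (hD hj.symm) _ _) (by simp),
      inner_self_eq_norm_sq_to_K]
    rfl
  exact_mod_cast this

theorem sum_norm_sq_ellTwoIndicator_le {ι : Type*} [Fintype ι] {D : ι → Set Γ}
    (hD : Pairwise fun i j => Disjoint (D i) (D j)) (ξ : EllTwo Γ) :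
    ∑ i, ‖ellTwoIndicator (D i) ξ‖ ^ 2 ≤ ‖ξ‖ ^ 2 := by
  have h1 := norm_sq_sum_ellTwoIndicator hD fun _ => ξ
  have h2 : inner ℂ ξ (∑ i, ellTwoIndicator (D i) ξ) =
      ((∑ i, ‖ellTwoIndicator (D i) ξ‖ ^ 2 : ℝ) : ℂ) := by
    rw [inner_sum, Complex.ofReal_sum]
    exact Finset.sum_congr rfl fun i _ => inner_ellTwoIndicator_self _ _
  have h3 := norm_inner_le_norm (𝕜 := ℂ) ξ (∑ i, ellTwoIndicator (D i) ξ)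
  rw [h2, Complex.norm_real, ← h1, Real.norm_of_nonneg (sq_nonneg _)] at h3
  rw [← h1]
  have : ‖∑ i, ellTwoIndicator (D i) ξ‖ ≤ ‖ξ‖ := by
    by_contra! hlt
    nlinarith [norm_nonneg ξ]
  gcongr

theorem sum_norm_ellTwoIndicator_le {ι : Type*} [Fintype ι] {D : ι → Set Γ}
    (hD : Pairwise fun i j => Disjoint (D i) (D j)) (ξ : EllTwo Γ) :
    ∑ i, ‖ellTwoIndicator (D i) ξ‖ ≤ √(Fintype.card ι) * ‖ξ‖ := by
  refine abs_le_of_sq_le_sq' ?_ (by positivity) |>.2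
  rw [mul_pow, Real.sq_sqrt (by positivity)]
  refine sq_sum_le_card_mul_sum_sq.trans ?_
  gcongr
  · rfl
  · exact sum_norm_sq_ellTwoIndicator_le hD ξ

/-- Powers' estimate: if each `X i` maps the functions that vanish on `D i` to functions supported
in `D i`, for pairwise disjoint sets `D i`, then `‖∑ i, X i‖` grows like the square root of the
number of summands. -/
theorem norm_sum_le_of_disjoint {ι : Type*} [Fintype ι] {D : ι → Set Γ}
    (hD : Pairwise fun i j => Disjoint (D i) (D j)) (X : ι → EllTwo Γ →L[ℂ] EllTwo Γ)
    {M : ℝ} (hM : 0 ≤ M) (hX : ∀ i, ‖X i‖ ≤ M)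
    (h : ∀ i ξ, ellTwoIndicator (D i)ᶜ (X i (ellTwoIndicator (D i)ᶜ ξ)) = 0) :
    ‖∑ i, X i‖ ≤ 2 * √(Fintype.card ι) * M := by
  refine ContinuousLinearMap.opNorm_le_bound _ (by positivity) fun ξ => ?_
  have hX' : ∀ i η, ‖X i η‖ ≤ M * ‖η‖ := fun i η =>
    ((X i).le_opNorm η).trans (by gcongr; exact hX i)
  -- With `P` the projection onto `D i`, the vanishing of `(1 - P) X (1 - P)` gives `X = P X + (1 -
  -- P) X P`. The first terms have orthogonal ranges; the second depend on orthogonal pieces of `ξ`.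
  -- Each sum costs a factor `√N`.
  have hsplit : ∀ i, X i ξ = ellTwoIndicator (D i) (X i ξ) +
      ellTwoIndicator (D i)ᶜ (X i (ellTwoIndicator (D i) ξ)) := by
    intro i
    conv_lhs => rw [← ellTwoIndicator_add_compl (D i) (X i ξ)]
    congr 1
    conv_lhs => rw [← ellTwoIndicator_add_compl (D i) ξ]
    rw [map_add, ellTwoIndicator_add, h, add_zero]
  have h1 : ‖∑ i, ellTwoIndicator (D i) (X i ξ)‖ ≤ √(Fintype.card ι) * (M * ‖ξ‖) := by
    refine abs_le_of_sq_le_sq' ?_ (by positivity) |>.2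
    rw [norm_sq_sum_ellTwoIndicator hD, mul_pow, Real.sq_sqrt (by positivity)]
    calc ∑ i, ‖ellTwoIndicator (D i) (X i ξ)‖ ^ 2 ≤ ∑ _i : ι, (M * ‖ξ‖) ^ 2 := by
          gcongr with i
          exact (norm_ellTwoIndicator_le _ _).trans (hX' i ξ)
      _ = Fintype.card ι * (M * ‖ξ‖) ^ 2 := by simp
  have h2 : ‖∑ i, ellTwoIndicator (D i)ᶜ (X i (ellTwoIndicator (D i) ξ))‖ ≤
      √(Fintype.card ι) * (M * ‖ξ‖) :=
    calc _ ≤ ∑ i, ‖ellTwoIndicator (D i)ᶜ (X i (ellTwoIndicator (D i) ξ))‖ := norm_sum_le _ _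
      _ ≤ ∑ i, M * ‖ellTwoIndicator (D i) ξ‖ := by
          gcongr with i
          exact (norm_ellTwoIndicator_le _ _).trans (hX' i _)
      _ ≤ M * (√(Fintype.card ι) * ‖ξ‖) := by
          rw [← Finset.mul_sum]
          gcongr
          exact sum_norm_ellTwoIndicator_le hD ξ
      _ = _ := by ring
  rw [sum_apply, Finset.sum_congr rfl fun i _ => hsplit i,
    Finset.sum_add_distrib]
  refine (norm_add_le _ _).trans ?_
  linarith

/-! ### Basis vectors -/

theorem delta_apply [DecidableEq Γ] (g h : Γ) : delta g h = if h = g then 1 else 0 := by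
  simp only [delta, lp.single_apply, Pi.single_apply]
  congr

theorem inner_delta_left (g : Γ) (ξ : EllTwo Γ) : inner ℂ (delta g) ξ = ξ g := by
  classical
  have := lp.inner_single_left (𝕜 := ℂ) (G := fun _ : Γ => ℂ) g (1 : ℂ) ξ
  rw [delta]
  refine Eq.trans ?_ (this.trans (by simp))
  congr

theorem norm_delta (g : Γ) : ‖delta g‖ = 1 := by
  classical
  rw [delta, lp.norm_single (by norm_num), norm_one]

theorem exists_apply_delta_ne_zero {T : EllTwo Γ →L[ℂ] EllTwo Γ} (hT : T ≠ 0) :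
    ∃ g, T (delta g) ≠ 0 := by
  classical
  by_contra! h
  refine hT (ContinuousLinearMap.ext fun ξ => ?_)
  have h1 := (lp.hasSum_single (p := 2) (by norm_num) ξ).mapL T
  have h0 : ∀ g, T (lp.single 2 g (ξ g)) = 0 := fun g => ?_
  · simp only [h0] at h1
    exact h1.unique hasSum_zero
  have : lp.single 2 g (ξ g) = (ξ g) • (delta g : EllTwo Γ) := by
    ext k
    simp [delta_apply, lp.single_apply, Pi.single_apply]
  rw [this, map_smul, h, smul_zero]

end Restriction

/-! ### The reduced group C*-algebra -/

section Reduced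

variable {Γ : Type*} [Group Γ]

theorem leftRegular_apply (g : Γ) (ξ : EllTwo Γ) (h : Γ) :
    leftRegular g ξ h = ξ (g⁻¹ * h) := rfl

variable (Γ) in
/-- The left regular representation as a homomorphism. -/
noncomputable def leftRegularHom : Γ →* (EllTwo Γ →L[ℂ] EllTwo Γ) where
  toFun := leftRegular
  map_one' := by ext ξ h; simp [leftRegular_apply]
  map_mul' g g' := by ext ξ h; simp [leftRegular_apply, mul_assoc]

theorem norm_leftRegular_le (g : Γ) : ‖leftRegular g‖ ≤ 1 :=
  (leftTranslation g).norm_toContinuousLinearMap_le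

theorem star_leftRegular (g : Γ) : star (leftRegular g) = leftRegular g⁻¹ := by
  rw [ContinuousLinearMap.star_eq_adjoint, eq_comm, ContinuousLinearMap.eq_adjoint_iff]
  intro ξ η
  have h := (leftTranslation g).inner_map_map (leftRegular g⁻¹ ξ) η
  have h2 : leftTranslation g (leftRegular g⁻¹ ξ) = ξ := by
    ext k
    exact congrArg ξ (by group)
  rw [h2] at h
  exact h.symm

theorem leftRegular_mem (g : Γ) : leftRegular g ∈ reducedCStarAlgebra Γ :=
  StarSubalgebra.le_topologicalClosure _ (StarAlgebra.subset_adjoin ℂ _ ⟨g, rfl⟩)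

variable (Γ) in
/-- The left regular representation in the reduced group C*-algebra. -/
noncomputable def reducedHom : Γ →* reducedCStarAlgebra Γ where
  toFun g := ⟨leftRegular g, leftRegular_mem g⟩
  map_one' := Subtype.ext (leftRegularHom Γ).map_one
  map_mul' g h := Subtype.ext ((leftRegularHom Γ).map_mul g h)

theorem coe_reducedHom (g : Γ) :
    (reducedHom Γ g : EllTwo Γ →L[ℂ] EllTwo Γ) = leftRegular g := rfl

instance : CompleteSpace (reducedCStarAlgebra Γ) :=
  (StarSubalgebra.isClosed_topologicalClosure _).completeSpace_coe

/-- The operators `λ(g)` are closed under products and adjoints, so their linear span is already a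
star-algebra. -/
theorem coe_reducedCStarAlgebra : (reducedCStarAlgebra Γ : Set (EllTwo Γ →L[ℂ] EllTwo Γ)) =
    closure (Submodule.span ℂ (Set.range (leftRegular (Γ := Γ)))) := by
  have h : Set.range (leftRegular (Γ := Γ)) ∪ star (Set.range (leftRegular (Γ := Γ))) =
      (MonoidHom.mrange (leftRegularHom Γ) : Set _) := by
    rw [MonoidHom.coe_mrange, Set.union_eq_left.2]
    · rfl
    · rintro x ⟨g, hg⟩
      exact ⟨g⁻¹, by rw [← star_leftRegular, hg, star_star]⟩
  have h2 := StarAlgebra.adjoin_eq_span (R := ℂ) (Set.range (leftRegular (Γ := Γ)))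
  rw [h, Submonoid.closure_eq] at h2
  rw [reducedCStarAlgebra, StarSubalgebra.topologicalClosure_coe]
  congr 1
  exact congrArg (fun S : Submodule ℂ _ => (S : Set (EllTwo Γ →L[ℂ] EllTwo Γ))) h2

theorem dense_span_range_reducedHom :
    Dense (Submodule.span ℂ (Set.range (reducedHom Γ)) : Set (reducedCStarAlgebra Γ)) := by
  intro a
  rw [closure_subtype]
  have h : (fun a : reducedCStarAlgebra Γ => (a : EllTwo Γ →L[ℂ] EllTwo Γ)) ''
      (Submodule.span ℂ (Set.range (reducedHom Γ)) : Set (reducedCStarAlgebra Γ)) =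
      Submodule.span ℂ (Set.range (leftRegular (Γ := Γ))) := by
    have := Submodule.map_span (reducedCStarAlgebra Γ).toSubalgebra.toSubmodule.subtype
      (Set.range (reducedHom Γ))
    rw [← Set.range_comp] at this
    exact congrArg (fun S : Submodule ℂ _ => (S : Set (EllTwo Γ →L[ℂ] EllTwo Γ))) this
  have ha : (a : EllTwo Γ →L[ℂ] EllTwo Γ) ∈ (reducedCStarAlgebra Γ : Set _) := a.2
  rw [coe_reducedCStarAlgebra, ← h] at ha
  exact ha

theorem reducedCStarAlgebra_induction {p : reducedCStarAlgebra Γ → Prop}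
    (hc : IsClosed {a | p a}) (hom : ∀ g, p (reducedHom Γ g))
    (add : ∀ a b, p a → p b → p (a + b)) (smul : ∀ (c : ℂ) a, p a → p (c • a))
    (a : reducedCStarAlgebra Γ) : p a := by
  refine closure_minimal (fun x hx => ?_) hc (dense_span_range_reducedHom a)
  refine Submodule.span_induction (p := fun x _ => p x) ?_ ?_ (fun a b _ _ => add a b)
    (fun c a _ => smul c a) hx
  · rintro _ ⟨g, rfl⟩
    exact hom g
  · simpa using smul 0 _ (hom 1)

/-- The functional `a ↦ ⟨ξ, a ξ⟩` on the reduced group C*-algebra. -/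
noncomputable def vectorFunctional (ξ : EllTwo Γ) : reducedCStarAlgebra Γ →ₗ[ℂ] ℂ where
  toFun a := inner ℂ ξ ((a : EllTwo Γ →L[ℂ] EllTwo Γ) ξ)
  map_add' a b := by simp
  map_smul' c a := by simp

theorem vectorFunctional_apply (ξ : EllTwo Γ) (a : reducedCStarAlgebra Γ) :
    vectorFunctional ξ a = inner ℂ ξ ((a : EllTwo Γ →L[ℂ] EllTwo Γ) ξ) := rfl

theorem canonicalTrace_eq_vectorFunctional :
    canonicalTrace Γ = vectorFunctional (delta 1) := rfl

theorem continuous_vectorFunctional (ξ : EllTwo Γ) : Continuous (vectorFunctional ξ) := by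
  change Continuous fun a : reducedCStarAlgebra Γ =>
    inner ℂ ξ ((a : EllTwo Γ →L[ℂ] EllTwo Γ) ξ)
  fun_prop

theorem canonicalTrace_reducedHom [DecidableEq Γ] (g : Γ) :
    canonicalTrace Γ (reducedHom Γ g) = if g = 1 then 1 else 0 := by
  rw [canonicalTrace_eq_vectorFunctional, vectorFunctional_apply, coe_reducedHom,
    leftRegular_delta, inner_delta_left, delta_apply]
  simp [eq_comm]

/-- A vector state that restricts to a class function on the group is tracial. -/
theorem isTracialState_vectorFunctional {ξ : EllTwo Γ} (hξ : ‖ξ‖ = 1)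
    (h : ∀ g k, vectorFunctional ξ (reducedHom Γ (g * k)) =
      vectorFunctional ξ (reducedHom Γ (k * g))) : IsTracialState (vectorFunctional ξ) where
  nonneg a ha := by
    rw [ContinuousLinearMap.nonneg_iff_isPositive] at ha
    exact ha.inner_nonneg_right ξ
  map_one := by
    rw [vectorFunctional_apply]
    simp [inner_self_eq_norm_sq_to_K, hξ]
  map_mul_comm a b := by
    have hcont := continuous_vectorFunctional ξ
    induction a using reducedCStarAlgebra_induction with
    | hc => exact isClosed_eq (by fun_prop) (by fun_prop)
    | add a a' ha ha' => rw [add_mul, mul_add, map_add, map_add, ha, ha']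
    | smul c a ha => rw [smul_mul_assoc, mul_smul_comm, map_smul, map_smul, ha]
    | hom g =>
      induction b using reducedCStarAlgebra_induction with
      | hc => exact isClosed_eq (by fun_prop) (by fun_prop)
      | add a a' ha ha' => rw [add_mul, mul_add, map_add, map_add, ha, ha']
      | smul c a ha => rw [smul_mul_assoc, mul_smul_comm, map_smul, map_smul, ha]
      | hom k => rw [← map_mul, ← map_mul, h]

theorem isTracialState_canonicalTrace : IsTracialState (canonicalTrace Γ) := by
  classical
  refine isTracialState_vectorFunctional (norm_delta 1) fun g k => ?_
  rw [← canonicalTrace_eq_vectorFunctional, canonicalTrace_reducedHom, canonicalTrace_reducedHom,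
    mul_eq_one_iff_eq_inv, mul_eq_one_iff_inv_eq]
  simp only [eq_comm]

end Reduced

/-! ### Powers groups are C*-simple and have the unique trace property -/

section Powers

variable {Γ : Type*} [Group Γ]

theorem exists_finsupp_norm_sub_lt (a : reducedCStarAlgebra Γ) {δ : ℝ} (hδ : 0 < δ) :
    ∃ z : Γ →₀ ℂ, ‖a - Finsupp.linearCombination ℂ (reducedHom Γ) z‖ < δ := by
  obtain ⟨x, hx, hax⟩ := Metric.mem_closure_iff.1 (dense_span_range_reducedHom a) δ hδ
  obtain ⟨z, rfl⟩ := (Finsupp.mem_span_range_iff_exists_finsupp).1 hx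
  exact ⟨z, by rwa [dist_eq_norm] at hax⟩

/-- The average of `a` over the conjugates by `γ j`, up to normalization. -/
noncomputable def sumConj {ι : Type*} [Fintype ι] (γ : ι → Γ) :
    reducedCStarAlgebra Γ →ₗ[ℂ] reducedCStarAlgebra Γ where
  toFun a := ∑ j, reducedHom Γ (γ j) * a * reducedHom Γ (γ j)⁻¹
  map_add' a b := by simp only [mul_add, add_mul, Finset.sum_add_distrib]
  map_smul' c a := by simp [Finset.smul_sum]

theorem sumConj_apply {ι : Type*} [Fintype ι] (γ : ι → Γ) (a : reducedCStarAlgebra Γ) :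
    sumConj γ a = ∑ j, reducedHom Γ (γ j) * a * reducedHom Γ (γ j)⁻¹ := rfl

theorem norm_reducedHom_le (g : Γ) : ‖reducedHom Γ g‖ ≤ 1 := norm_leftRegular_le g

theorem norm_conj_le (g : Γ) (a : reducedCStarAlgebra Γ) :
    ‖reducedHom Γ g * a * reducedHom Γ g⁻¹‖ ≤ ‖a‖ :=
  calc _ ≤ ‖reducedHom Γ g‖ * ‖a‖ * ‖reducedHom Γ g⁻¹‖ :=
        (norm_mul_le _ _).trans (by gcongr; exact norm_mul_le _ _)
    _ ≤ 1 * ‖a‖ * 1 := by gcongr <;> exact norm_reducedHom_le _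
    _ = ‖a‖ := by ring

theorem norm_sumConj_le {ι : Type*} [Fintype ι] (γ : ι → Γ) (a : reducedCStarAlgebra Γ) :
    ‖sumConj γ a‖ ≤ Fintype.card ι * ‖a‖ :=
  (norm_sum_le _ _).trans <|
    (Finset.sum_le_sum fun j _ => norm_conj_le (γ j) a).trans (by simp)

theorem sumConj_one {ι : Type*} [Fintype ι] (γ : ι → Γ) :
    sumConj γ 1 = (Fintype.card ι : ℂ) • (1 : reducedCStarAlgebra Γ) := by
  simp only [sumConj_apply, mul_one, ← map_mul, mul_inv_cancel, map_one, Finset.sum_const,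
    Finset.card_univ, ← Nat.cast_smul_eq_nsmul ℂ]

theorem conj_linearCombination_apply (g : Γ) (z : Γ →₀ ℂ) (ξ : EllTwo Γ) (h : Γ) :
    (reducedHom Γ g * Finsupp.linearCombination ℂ (reducedHom Γ) z * reducedHom Γ g⁻¹ :
      reducedCStarAlgebra Γ).1 ξ h = ∑ f ∈ z.support, z f * ξ (g * (f⁻¹ * (g⁻¹ * h))) := by
  have h1 : (reducedHom Γ g * Finsupp.linearCombination ℂ (reducedHom Γ) z * reducedHom Γ g⁻¹ :
      reducedCStarAlgebra Γ) = ∑ f ∈ z.support, z f • reducedHom Γ (g * f * g⁻¹) := by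
    simp only [Finsupp.linearCombination_apply, Finsupp.sum, Finset.mul_sum, Finset.sum_mul,
      map_mul, mul_smul_comm, smul_mul_assoc]
  rw [h1, AddSubmonoidClass.coe_finsetSum, sum_apply, lp.coeFn_sum, Finset.sum_apply]
  refine Finset.sum_congr rfl fun f _ => ?_
  have : (z f • reducedHom Γ (g * f * g⁻¹) : reducedCStarAlgebra Γ).1 ξ h =
    z f * ξ ((g * f * g⁻¹)⁻¹ * h) := rfl
  rw [this]
  congr 2
  group

/-- Powers' averaging: the sets `γ j • D` are disjoint, and since `f C` misses `C`, the `j`-th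
conjugate sends functions vanishing on `γ j • D` to functions supported there. -/
theorem IsPowersGroup.exists_norm_sumConj_le (hP : IsPowersGroup Γ) {z : Γ →₀ ℂ} (hz : z 1 = 0)
    {δ : ℝ} (hδ : 0 < δ) : ∃ (N : ℕ) (γ : Fin N → Γ), 0 < N ∧
      ‖sumConj γ (Finsupp.linearCombination ℂ (reducedHom Γ) z)‖ ≤ N * δ := by
  rcases eq_or_ne z 0 with rfl | hz0
  · exact ⟨1, fun _ => 1, one_pos, by simpa using hδ.le⟩
  set X := Finsupp.linearCombination ℂ (reducedHom Γ) z with hX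
  -- Chosen so that `2 * √N * ‖X‖ ≤ N * δ`.
  obtain ⟨N, hN⟩ := exists_nat_gt ((2 * ‖X‖ / δ) ^ 2)
  have hN0 : 0 < N := by
    have : (0 : ℝ) < N := (sq_nonneg _).trans_lt hN
    exact_mod_cast this
  obtain ⟨C, D, γ, hCD, -, hC, hD⟩ := hP z.support (Finsupp.support_nonempty_iff.2 hz0)
    (by simpa using hz) N hN0
  refine ⟨N, γ, hN0, ?_⟩
  have hmemC : ∀ x, x ∉ D → x ∈ C := fun x hx =>
    ((Set.ext_iff.1 hCD x).2 trivial).resolve_right hx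
  have key := norm_sum_le_of_disjoint (D := fun j => γ j • D)
    (fun j k hjk => Set.disjoint_iff_inter_eq_empty.2 (hD j k hjk))
    (fun j => (reducedHom Γ (γ j) * X * reducedHom Γ (γ j)⁻¹ : reducedCStarAlgebra Γ).1)
    (norm_nonneg X) (fun j => norm_conj_le (γ j) X) (fun j ξ => ?_)
  · rw [Fintype.card_fin] at key
    have h1 : ‖sumConj γ X‖ ≤ 2 * √N * ‖X‖ := by
      refine le_trans (le_of_eq ?_) key
      rw [← AddSubmonoidClass.coe_finsetSum]
      rfl
    have h2 : 2 * ‖X‖ / δ ≤ √N := Real.le_sqrt_of_sq_le hN.le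
    rw [div_le_iff₀ hδ] at h2
    calc _ ≤ √N * (2 * ‖X‖) := h1.trans (le_of_eq (by ring))
      _ ≤ √N * (√N * δ) := by gcongr
      _ = N * δ := by rw [← mul_assoc, Real.mul_self_sqrt (by positivity)]
  · ext g
    rw [ellTwoIndicator_apply]
    refine Set.indicator_apply_eq_zero.2 fun hg => ?_
    rw [conj_linearCombination_apply]
    refine Finset.sum_eq_zero fun f hf => mul_eq_zero_of_right _ ?_
    rw [ellTwoIndicator_apply]
    refine Set.indicator_apply_eq_zero.2 fun hfg => ?_
    rw [Set.mem_compl_iff, Set.mem_smul_set_iff_inv_smul_mem] at hg hfg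
    refine absurd ?_ (Set.eq_empty_iff_forall_notMem.1 (hC f hf) ((γ j)⁻¹ * g))
    exact ⟨⟨_, hmemC _ hfg, by simp⟩, hmemC _ hg⟩

/-- A self-adjoint `b` lies between `-‖b‖` and `‖b‖`, which positivity transfers to `φ b`. The
factor 2 comes from adding real and imaginary parts; any constant would serve. -/
theorem IsTracialState.norm_apply_le {φ : reducedCStarAlgebra Γ →ₗ[ℂ] ℂ} (hφ : IsTracialState φ)
    (a : reducedCStarAlgebra Γ) : ‖φ a‖ ≤ 2 * ‖a‖ := by
  have key : ∀ b : reducedCStarAlgebra Γ, IsSelfAdjoint b → ‖φ b‖ ≤ ‖b‖ := by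
    intro b hb
    have hb' : IsSelfAdjoint (b : EllTwo Γ →L[ℂ] EllTwo Γ) := congrArg Subtype.val hb
    have h1 : 0 ≤ φ ((‖b‖ : ℂ) • 1 - b) := by
      refine hφ.nonneg _ ?_
      have := hb'.le_algebraMap_norm_self
      rw [Algebra.algebraMap_eq_smul_one] at this
      exact sub_nonneg.2 this
    have h2 : 0 ≤ φ ((‖b‖ : ℂ) • 1 + b) := by
      refine hφ.nonneg _ ?_
      have := hb'.neg.le_algebraMap_norm_self
      rw [Algebra.algebraMap_eq_smul_one, norm_neg] at this
      have h3 := sub_nonneg.2 this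
      rw [sub_neg_eq_add] at h3
      exact h3
    rw [map_sub, map_smul, hφ.map_one, smul_eq_mul, mul_one, Complex.le_def] at h1
    rw [map_add, map_smul, hφ.map_one, smul_eq_mul, mul_one, Complex.le_def] at h2
    simp only [Complex.zero_re, Complex.sub_re, Complex.ofReal_re, Complex.zero_im,
      Complex.sub_im, Complex.ofReal_im, Complex.add_re, Complex.add_im] at h1 h2
    have him : φ b = ((φ b).re : ℂ) := Complex.ext rfl (by simpa using h2.2.symm)
    rw [him, Complex.norm_real, Real.norm_eq_abs, abs_le]
    exact ⟨by linarith [h2.1], by linarith [h1.1]⟩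
  have hre : ‖(realPart a : reducedCStarAlgebra Γ)‖ ≤ ‖a‖ := realPart.norm_le a
  have him : ‖(imaginaryPart a : reducedCStarAlgebra Γ)‖ ≤ ‖a‖ := imaginaryPart.norm_le a
  calc ‖φ a‖ = ‖φ (realPart a) + Complex.I * φ (imaginaryPart a)‖ := by
        conv_lhs => rw [← realPart_add_I_smul_imaginaryPart a]
        simp
    _ ≤ ‖φ (realPart a)‖ + ‖φ (imaginaryPart a)‖ := (norm_add_le _ _).trans (by simp)
    _ ≤ ‖a‖ + ‖a‖ := add_le_add ((key _ (realPart a).2).trans hre)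
        ((key _ (imaginaryPart a).2).trans him)
    _ = 2 * ‖a‖ := by ring

theorem IsTracialState.apply_sumConj {φ : reducedCStarAlgebra Γ →ₗ[ℂ] ℂ} (hφ : IsTracialState φ)
    {ι : Type*} [Fintype ι] (γ : ι → Γ) (a : reducedCStarAlgebra Γ) :
    φ (sumConj γ a) = Fintype.card ι * φ a := by
  have : ∀ j, φ (reducedHom Γ (γ j) * a * reducedHom Γ (γ j)⁻¹) = φ a := fun j => by
    rw [hφ.map_mul_comm, ← mul_assoc, ← (reducedHom Γ).map_mul, inv_mul_cancel,
      (reducedHom Γ).map_one, one_mul]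
  simp [sumConj_apply, this]

/-- A trace does not change under averaging over conjugates, while the averages of `λ(g)`, `g ≠ 1`,
become arbitrarily small. So it vanishes on these `λ(g)`, and continuity determines it. -/
theorem IsPowersGroup.hasUniqueTraceProperty (hP : IsPowersGroup Γ) :
    HasUniqueTraceProperty Γ := by
  classical
  refine fun φ => ⟨fun hφ => ?_, fun h => h ▸ isTracialState_canonicalTrace⟩
  have hzero : ∀ g : Γ, g ≠ 1 → φ (reducedHom Γ g) = 0 := by
    intro g hg
    refine norm_le_zero_iff.1 (le_of_forall_pos_le_add fun δ hδ => ?_)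
    obtain ⟨N, γ, hN, h⟩ := hP.exists_norm_sumConj_le (z := Finsupp.single g 1)
      (Finsupp.single_eq_of_ne hg.symm) (half_pos hδ)
    rw [Finsupp.linearCombination_single, one_smul] at h
    have h1 := hφ.norm_apply_le (sumConj γ (reducedHom Γ g))
    rw [hφ.apply_sumConj, norm_mul, Fintype.card_fin, Complex.norm_natCast] at h1
    have hN' : (0 : ℝ) < N := by exact_mod_cast hN
    refine le_of_mul_le_mul_left ?_ hN'
    linarith
  have hcont : Continuous φ := AddMonoidHomClass.continuous_of_bound φ 2 hφ.norm_apply_le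
  have hcont' : Continuous (canonicalTrace Γ) := continuous_vectorFunctional _
  ext a
  induction a using reducedCStarAlgebra_induction with
  | hc => exact isClosed_eq hcont hcont'
  | add a b ha hb => rw [map_add, map_add, ha, hb]
  | smul c a ha => rw [map_smul, map_smul, ha]
  | hom g =>
    rw [canonicalTrace_reducedHom]
    split_ifs with h
    · rw [h, map_one, hφ.map_one]
    · exact hzero g h

theorem norm_canonicalTrace_le (a : reducedCStarAlgebra Γ) : ‖canonicalTrace Γ a‖ ≤ ‖a‖ := by
  rw [canonicalTrace_eq_vectorFunctional, vectorFunctional_apply]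
  refine (norm_inner_le_norm _ _).trans ?_
  rw [norm_delta, one_mul]
  simpa [norm_delta] using (a : EllTwo Γ →L[ℂ] EllTwo Γ).le_opNorm (delta 1)

theorem TwoSidedIdeal.smul_mem_of_algebra {R A : Type*} [CommRing R] [Ring A] [Algebra R A]
    (I : TwoSidedIdeal A) (c : R) {a : A} (ha : a ∈ I) : c • a ∈ I := by
  rw [Algebra.smul_def]
  exact I.mul_mem_left _ _ ha

/-- The trace of `d* d` is `‖d δ₁‖²`. A right translate `d` of a nonzero element of the ideal makes
it nonzero, and scaling finishes. -/
theorem TwoSidedIdeal.exists_mem_canonicalTrace_eq_one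
    {I : TwoSidedIdeal (reducedCStarAlgebra Γ)} (hI : I ≠ ⊥) :
    ∃ b ∈ I, canonicalTrace Γ b = 1 := by
  obtain ⟨a, haI, ha⟩ : ∃ a ∈ I, a ≠ 0 := by
    by_contra! h
    exact hI (le_bot_iff.1 fun x hx => (TwoSidedIdeal.mem_bot _).2 (h x hx))
  obtain ⟨g, hg⟩ := exists_apply_delta_ne_zero (T := (a : EllTwo Γ →L[ℂ] EllTwo Γ))
    (fun h => ha (Subtype.ext h))
  set d := a * reducedHom Γ g with hd
  have hdI : star d * d ∈ I := I.mul_mem_left _ _ (I.mul_mem_right _ _ haI)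
  have hτ : canonicalTrace Γ (star d * d) ≠ 0 := by
    have h1 : (d : EllTwo Γ →L[ℂ] EllTwo Γ) (delta 1) ≠ 0 := by
      have : (d : EllTwo Γ →L[ℂ] EllTwo Γ) (delta 1) =
        (a : EllTwo Γ →L[ℂ] EllTwo Γ) (leftRegular g (delta 1)) := rfl
      rwa [this, leftRegular_delta, mul_one]
    have h2 : canonicalTrace Γ (star d * d) =
        inner ℂ ((d : EllTwo Γ →L[ℂ] EllTwo Γ) (delta 1))
          ((d : EllTwo Γ →L[ℂ] EllTwo Γ) (delta 1)) :=
      ContinuousLinearMap.adjoint_inner_right (d : EllTwo Γ →L[ℂ] EllTwo Γ) _ _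
    rw [h2]
    exact inner_self_ne_zero.2 h1
  exact ⟨(canonicalTrace Γ (star d * d))⁻¹ • (star d * d), I.smul_mem_of_algebra _ hdI, by
    rw [map_smul, smul_eq_mul, inv_mul_cancel₀ hτ]⟩

theorem canonicalTrace_linearCombination (z : Γ →₀ ℂ) :
    canonicalTrace Γ (Finsupp.linearCombination ℂ (reducedHom Γ) z) = z 1 := by
  classical
  rw [Finsupp.linearCombination_apply, Finsupp.sum, map_sum]
  simp only [map_smul, canonicalTrace_reducedHom, smul_eq_mul, mul_ite, mul_one, mul_zero,
    Finset.sum_ite_eq', Finsupp.mem_support_iff, ite_not, ite_eq_right_iff]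
  exact fun h => h.symm

theorem linearCombination_eq_smul_one_add (z : Γ →₀ ℂ) :
    Finsupp.linearCombination ℂ (reducedHom Γ) z =
      z 1 • 1 + Finsupp.linearCombination ℂ (reducedHom Γ) (z.erase 1) := by
  conv_lhs => rw [← Finsupp.single_add_erase 1 z]
  rw [map_add, Finsupp.linearCombination_single, (reducedHom Γ).map_one]

theorem IsPowersGroup.exists_norm_sumConj_sub_lt (hP : IsPowersGroup Γ)
    {b : reducedCStarAlgebra Γ} (hb : canonicalTrace Γ b = 1) :
    ∃ (N : ℕ) (γ : Fin N → Γ), 0 < N ∧ ‖sumConj γ b - (N : ℂ) • 1‖ < N := by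
  -- Three errors of at most `N / 4` each arise: the coefficient at `1`, the averaged remaining
  -- coefficients and the approximation of `b`. Together they stay below `N`.
  obtain ⟨z, hz⟩ := exists_finsupp_norm_sub_lt b (δ := 1 / 4) (by norm_num)
  obtain ⟨r, hr⟩ : ∃ r, r = b - Finsupp.linearCombination ℂ (reducedHom Γ) z := ⟨_, rfl⟩
  rw [← hr] at hz
  have hz1 : ‖z 1 - 1‖ < 1 / 4 := by
    have h1 : z 1 - 1 = -canonicalTrace Γ r := by
      rw [hr, map_sub, hb, canonicalTrace_linearCombination, neg_sub]
    rw [h1, norm_neg]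
    exact (norm_canonicalTrace_le _).trans_lt hz
  obtain ⟨N, γ, hN, hX⟩ := hP.exists_norm_sumConj_le (z := z.erase 1) Finsupp.erase_same
    (δ := 1 / 4) (by norm_num)
  rw [eq_sub_iff_add_eq, linearCombination_eq_smul_one_add] at hr
  generalize Finsupp.linearCombination ℂ (reducedHom Γ) (z.erase 1) = X at hX hr
  have hN' : (0 : ℝ) < N := by exact_mod_cast hN
  have hr' := norm_sumConj_le γ r
  have hone := sumConj_one γ
  rw [Fintype.card_fin] at hr' hone
  have hsum : sumConj γ b - (N : ℂ) • 1 =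
      ((N : ℂ) * (z 1 - 1)) • (1 : reducedCStarAlgebra Γ) + (sumConj γ X + sumConj γ r) := by
    rw [← hr, map_add, map_add, map_smul, hone, smul_smul, mul_sub, sub_smul, mul_one,
      mul_comm (z 1)]
    abel
  have hn1 : ‖(1 : reducedCStarAlgebra Γ)‖ ≤ 1 := by
    have := norm_reducedHom_le (1 : Γ)
    rwa [(reducedHom Γ).map_one] at this
  refine ⟨N, γ, hN, ?_⟩
  rw [hsum]
  have h1 : ‖((N : ℂ) * (z 1 - 1)) • (1 : reducedCStarAlgebra Γ)‖ ≤ N * (1 / 4) := by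
    rw [norm_smul, norm_mul, Complex.norm_natCast]
    calc _ ≤ (N : ℝ) * (1 / 4) * 1 := by gcongr
      _ = _ := mul_one _
  have h2 : ‖sumConj γ r‖ ≤ N * (1 / 4) := hr'.trans (by gcongr)
  have h3 := norm_add_le (((N : ℂ) * (z 1 - 1)) • (1 : reducedCStarAlgebra Γ))
    (sumConj γ X + sumConj γ r)
  have h4 := norm_add_le (sumConj γ X) (sumConj γ r)
  linarith

/-- A nonzero ideal contains an average of conjugates at distance less than 1 from the identity, and
such an element is invertible. -/
theorem IsPowersGroup.isCStarSimple (hP : IsPowersGroup Γ) : IsCStarSimple Γ := by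
  intro I _
  rcases eq_or_ne I ⊥ with hI | hI
  · exact .inl hI
  obtain ⟨b, hbI, hb⟩ := TwoSidedIdeal.exists_mem_canonicalTrace_eq_one hI
  obtain ⟨N, γ, hN, hlt⟩ := hP.exists_norm_sumConj_sub_lt hb
  have hN' : (0 : ℝ) < N := by exact_mod_cast hN
  have hNC : (N : ℂ) ≠ 0 := by exact_mod_cast hN.ne'
  have hsI : sumConj γ b ∈ I := by
    rw [sumConj_apply]
    exact sum_mem fun j _ => I.mul_mem_right _ _ (I.mul_mem_left _ _ hbI)
  have hu : IsUnit ((N : ℂ)⁻¹ • sumConj γ b) := by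
    have h1 : ‖1 - (N : ℂ)⁻¹ • sumConj γ b‖ < 1 := by
      have : 1 - (N : ℂ)⁻¹ • sumConj γ b = -((N : ℂ)⁻¹ • (sumConj γ b - (N : ℂ) • 1)) := by
        rw [smul_sub, smul_smul, inv_mul_cancel₀ hNC, one_smul, neg_sub]
      rw [this, norm_neg, norm_smul, norm_inv, Complex.norm_natCast, inv_mul_lt_iff₀ hN',
        mul_one]
      exact hlt
    have h2 := isUnit_one_sub_of_norm_lt_one h1
    rwa [sub_sub_cancel] at h2
  obtain ⟨u, hu⟩ := hu
  refine .inr (I.one_mem_iff.1 ?_)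
  rw [← u.inv_mul, hu]
  exact I.mul_mem_left _ _ (I.smul_mem_of_algebra _ hsI)

end Powers

/-! ### Groups with a nontrivial finite normal subgroup -/

section FiniteNormal

variable {Γ : Type*} [Group Γ] (K : Subgroup Γ) [K.Normal] [Finite K]

theorem IsICC.eq_bot_of_finite (h : IsICC Γ) : K = ⊥ := by
  refine (Subgroup.eq_bot_iff_forall K).2 fun k hk => ?_
  by_contra hne
  refine h k hne (Set.Finite.subset (Set.toFinite (K : Set Γ)) ?_)
  rintro _ ⟨c, rfl⟩
  exact Subgroup.Normal.conj_mem ‹_› k hk c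

/-- The normalized indicator function of `K` defines a vector state equal to the indicator of `K` on
the group. As `K` is normal this is a class function, so the state is a trace. -/
theorem HasUniqueTraceProperty.eq_bot_of_finite (h : HasUniqueTraceProperty Γ) : K = ⊥ := by
  classical
  have := Fintype.ofFinite K
  set ξ : EllTwo Γ := ∑ k : K, delta (k : Γ) with hξ
  have hξg : ∀ g, ξ g = if g ∈ K then 1 else 0 := by
    intro g
    rw [hξ, lp.coeFn_sum, Finset.sum_apply]
    simp only [delta_apply]
    split_ifs with hg
    · rw [Finset.sum_eq_single ⟨g, hg⟩] <;> aesop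
    · exact Finset.sum_eq_zero fun k _ => if_neg (by rintro rfl; exact hg k.2)
  have hclass : ∀ g, inner ℂ ξ (leftRegular g ξ) =
      if g ∈ K then (Fintype.card K : ℂ) else 0 := by
    intro g
    conv_lhs => rw [hξ, sum_inner]
    simp only [inner_delta_left, ← hξ, leftRegular_apply, hξg]
    have : ∀ k : K, g⁻¹ * k ∈ K ↔ g ∈ K := fun k => by
      rw [Subgroup.mul_mem_cancel_right _ k.2, inv_mem_iff]
    simp [this]
  have hcard : (0 : ℝ) < Fintype.card K := by exact_mod_cast Fintype.card_pos
  have hnorm : ‖ξ‖ ^ 2 = Fintype.card K := by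
    have h1 := inner_self_eq_norm_sq_to_K (𝕜 := ℂ) ξ
    have h2 := hclass 1
    rw [if_pos (one_mem K)] at h2
    have h3 : leftRegular 1 ξ = ξ := by ext k; simp [leftRegular_apply]
    rw [h3, h1] at h2
    exact Complex.ofReal_injective (by simpa using h2)
  set c : ℂ := ((‖ξ‖⁻¹ : ℝ) : ℂ) with hc
  have hξ0 : ‖ξ‖ ≠ 0 := fun h0 => by
    rw [← hnorm, h0] at hcard
    simp at hcard
  have hval : ∀ g, vectorFunctional (c • ξ) (reducedHom Γ g) = if g ∈ K then 1 else 0 := by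
    intro g
    rw [vectorFunctional_apply, coe_reducedHom, map_smul, inner_smul_left, inner_smul_right,
      hclass, hc, Complex.conj_ofReal]
    split_ifs
    · have : (Fintype.card K : ℂ) = ((‖ξ‖ : ℝ) : ℂ) ^ 2 := by
        rw [← Complex.ofReal_pow, hnorm]; simp
      rw [this]
      have : ((‖ξ‖ : ℝ) : ℂ) ≠ 0 := by exact_mod_cast hξ0
      push_cast
      field_simp
    · simp
  have htr : IsTracialState (vectorFunctional (c • ξ)) := by
    refine isTracialState_vectorFunctional ?_ fun g k => ?_
    · rw [norm_smul, hc, Complex.norm_real, norm_inv, norm_norm, inv_mul_cancel₀ hξ0]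
    · simp only [hval, Subgroup.Normal.mem_comm_iff ‹K.Normal› (a := g)]
  refine (Subgroup.eq_bot_iff_forall K).2 fun k hk => ?_
  have h1 := congrArg (fun ψ => ψ (reducedHom Γ k)) ((h _).1 htr)
  simp only [hval, if_pos hk, canonicalTrace_reducedHom] at h1
  by_contra hne
  simp [hne] at h1

/-- The sum `q` of the `λ(k)`, `k ∈ K`, is central because `K` is normal. Its annihilator is a
closed ideal that contains every `λ(k) - 1` but not `1`. -/
theorem IsCStarSimple.eq_bot_of_finite (h : IsCStarSimple Γ) : K = ⊥ := by
  classical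
  have := Fintype.ofFinite K
  set q : reducedCStarAlgebra Γ := ∑ k : K, reducedHom Γ k with hq
  have hcomm : ∀ a, a * q = q * a := by
    intro a
    induction a using reducedCStarAlgebra_induction with
    | hc => exact isClosed_eq (by fun_prop) (by fun_prop)
    | add a b ha hb => rw [add_mul, mul_add, ha, hb]
    | smul c a ha => rw [smul_mul_assoc, mul_smul_comm, ha]
    | hom g =>
      rw [hq, Finset.mul_sum, Finset.sum_mul]
      refine Fintype.sum_equiv (MulAut.conjNormal g).toEquiv _ _ fun k => ?_
      rw [← map_mul, ← map_mul]
      simp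
  let I : TwoSidedIdeal (reducedCStarAlgebra Γ) := TwoSidedIdeal.mk' {a | a * q = 0}
    (by simp) (fun {a b} ha hb => by
      change _ * q = 0 at *
      rw [add_mul, ha, hb, add_zero])
    (fun {a} ha => by
      change _ * q = 0 at *
      rw [neg_mul, ha, neg_zero])
    (fun {a b} hb => by
      change _ * q = 0 at *
      rw [mul_assoc, hb, mul_zero])
    (fun {a b} ha => by
      change _ * q = 0 at *
      rw [mul_assoc, hcomm, ← mul_assoc, ha, zero_mul])
  have hmem : ∀ a, a ∈ I ↔ a * q = 0 := TwoSidedIdeal.mem_mk' _ _ _ _ _ _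
  have hclosed : IsClosed (I : Set (reducedCStarAlgebra Γ)) := by
    rw [TwoSidedIdeal.coe_mk']
    exact isClosed_eq (by fun_prop) continuous_const
  have hτq : canonicalTrace Γ q = 1 := by
    rw [hq, map_sum]
    simp [canonicalTrace_reducedHom]
  refine (Subgroup.eq_bot_iff_forall K).2 fun k hk => ?_
  have hk1 : reducedHom Γ k - 1 ∈ I := by
    rw [hmem, sub_mul, one_mul, sub_eq_zero, hq, Finset.mul_sum]
    exact Fintype.sum_equiv (Equiv.mulLeft (⟨k, hk⟩ : K)) _ _ fun j => by simp
  rcases h I hclosed with hI | hI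
  · rw [hI, TwoSidedIdeal.mem_bot, sub_eq_zero] at hk1
    have h1 := congrArg (canonicalTrace Γ) (hk1.trans (map_one (reducedHom Γ)).symm)
    rw [canonicalTrace_reducedHom, canonicalTrace_reducedHom] at h1
    by_contra hne
    simp [hne] at h1
  · have h1 := (hmem 1).1 (hI ▸ trivial)
    rw [one_mul] at h1
    simp [h1] at hτq

end FiniteNormal

/-! ### The equivalences -/

theorem mainTheorem7 {G : Type*} [Group G] {H : Subgroup G} (θ : H →* G)
    (hθ : Function.Injective θ) (hna : HNN.NonAscending θ)
    (hfin : ((H : Set G) ∩ (θ.range : Set G)).Finite)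
    (S : ℤˣ → Set G) (hS : HNN.IsTransversal θ S) (ε : ℤˣ) :
    List.TFAE [
      IsICC (HNN.Ext θ hθ),
      HNN.kernel θ hθ = ⊥,
      HNN.interior θ hθ S ε = ⊥,
      IsPowersGroup (HNN.Ext θ hθ),
      IsCStarSimple (HNN.Ext θ hθ),
      HasUniqueTraceProperty (HNN.Ext θ hθ)] := by
  have := HNN.finite_kernel (hθ := hθ) hna hfin hS
  tfae_have 1 → 2 := fun h => h.eq_bot_of_finite _
  tfae_have 5 → 2 := fun h => h.eq_bot_of_finite _
  tfae_have 6 → 2 := fun h => h.eq_bot_of_finite _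
  tfae_have 3 → 2 := fun h => le_bot_iff.1 <|
    (HNN.kernel_le_quasiKernel S ε).trans (Subgroup.le_normalClosure.trans h.le)
  tfae_have 2 → 3 := fun h => le_bot_iff.1 <| Subgroup.normalClosure_le_normal <|
    (HNN.quasiKernel_le_kernel hna hfin hS ε).trans h.le
  tfae_have 2 → 4 := HNN.isPowersGroup_of_kernel_eq_bot hna hfin hS
  tfae_have 4 → 1 := IsPowersGroup.isICC
  tfae_have 4 → 5 := IsPowersGroup.isCStarSimple
  tfae_have 4 → 6 := IsPowersGroup.hasUniqueTraceProperty
  tfae_finish
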